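/- For integers $l_1,l_2,l\ge 0$ and $m_1,m_2,m\in\mathbb{Z}$ let $C^{lm}_{l_1m_1l_2m_2}$ denote the Clebsch-Gordan coefficients of $SO(3)$ (real, with the standard Condon-Shortley phases); that is, $C^{lm}_{l_1m_1l_2m_2}=0$ unless $|m_1|\le l_1$, $|m_2|\le l_2$, $|m|\le l$, $m_1+m_2=m$ and $|l_1-l_2|\le l\le l_1+l_2$, and in that case $$C^{lm}_{l_1m_1l_2m_2}=\sqrt{\tfrac{(2l+1)(l_1+l_2-l)!\,(l_1+l-l_2)!\,(l_2+l-l_1)!}{(l_1+l_2+l+1)!}}\;\sqrt{(l_1+m_1)!(l_1-m_1)!(l_2+m_2)!(l_2-m_2)!(l+m)!(l-m)!}$$ $$\times\sum_k\frac{(-1)^k}{k!\,(l_1+l_2-l-k)!\,(l_1-m_1-k)!\,(l_2+m_2-k)!\,(l-l_2+m_1+k)!\,(l-l_1-m_2+k)!},$$ where $k$ runs over the integers for which all factorials have non-negative arguments. Let the Wigner $6j$ coefficients be $$\begin{Bmatrix} l_1&l_2&l_3\\ l_4&l_5&l_6\end{Bmatrix}=\frac{(-1)^{l_1+l_2+l_4+l_5}}{\sqrt{(2l_3+1)(2l_6+1)}}\sum_{m_1,m_2,m_3,m_4,m_6}C^{l_3m_3}_{l_1m_1l_2m_2}C^{l_5m_5}_{l_1m_1l_6m_6}C^{l_5m_5}_{l_3m_3l_4m_4}C^{l_6m_6}_{l_2m_2l_4m_4},$$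 where each $m_i$ in the sum runs over $-l_i,\dots,l_i$ and $m_5$ is fixed (the value is the same for every $|m_5|\le l_5$; take $m_5=0$). Then there is a constant $c>0$ such that for all integers $l,l_1,l_2,j_1,j_2\ge 0$, $$\sum_{s=0}^{2l}(2s+1)(2l+1)\bigl(C^{l0}_{l0s0}\bigr)^2\begin{Bmatrix} l_1&j_1&l\\ l&s&l_2\end{Bmatrix}\begin{Bmatrix} l_1&j_2&l\\ l&s&l_2\end{Bmatrix}\le c\,\max\Bigl[\tfrac{1}{\sqrt[5]{2l_1+1}}\wedge\tfrac{1}{\sqrt[5]{2l_2+1}},\ \tfrac{1}{\sqrt[5]{2j_1+1}}\wedge\tfrac{1}{\sqrt[5]{2j_2+1}}\Bigr],$$ where $a\wedge b=\min(a,b)$. (The sum over $s$ extends over all $s$ for which $C^{l0}_{l0s0}$ can be non-zero.) -/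

import Mathlib

open scoped Nat

/-- The reciprocal factorial `1 / n!`, with the usual convention that it is `0` for negative `n`. -/
noncomputable def recipFactorial (n : ℤ) : ℝ :=
  if 0 ≤ n then 1 / ((n.toNat)! : ℝ) else 0

/-- The Clebsch-Gordan coefficient `C_{l₁ m₁ l₂ m₂}^{l m}` of `SO(3)`
(standard real Condon-Shortley normalization), by its closed expression.
It is `0` unless the indices satisfy `|mᵢ| ≤ lᵢ`, `|m| ≤ l`, `m₁ + m₂ = m`
and the triangle conditions `|l₁ - l₂| ≤ l ≤ l₁ + l₂`.  All factorials outside the sum then have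
non-negative arguments, and only finitely many `k` (those for which the six factorials
in the sum have non-negative arguments) contribute, all of them in `0, …, l₁ + l₂ - l`. -/
noncomputable def clebschGordan (l₁ : ℕ) (m₁ : ℤ) (l₂ : ℕ) (m₂ : ℤ) (l : ℕ) (m : ℤ) : ℝ :=
  if |m₁| ≤ l₁ ∧ |m₂| ≤ l₂ ∧ |m| ≤ l ∧ m₁ + m₂ = m ∧
      l ≤ l₁ + l₂ ∧ l₁ ≤ l₂ + l ∧ l₂ ≤ l₁ + l then
    √((2 * l + 1) * (l₁ + l₂ - l)! * (l₁ + l - l₂)! * (l₂ + l - l₁)! / (l₁ + l₂ + l + 1)!) *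
    √((l₁ + m₁).toNat ! * (l₁ - m₁).toNat ! * (l₂ + m₂).toNat ! * (l₂ - m₂).toNat ! *
        (l + m).toNat ! * (l - m).toNat !) *
    ∑ k ∈ Finset.range (l₁ + l₂ + 1), (-1 : ℝ) ^ k *
      (recipFactorial k * recipFactorial (l₁ + l₂ - l - k) *
        recipFactorial (l₁ - m₁ - k) * recipFactorial (l₂ + m₂ - k) *
        recipFactorial (l - l₂ + m₁ + k) * recipFactorial (l - l₁ - m₂ + k))
  else 0

/-- The Wigner `6j` coefficient `{l₁ l₂ l₃; l₄ l₅ l₆}` in terms of Clebsch-Gordan coefficients.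
The projection `m₅` belonging to `l₅` is kept fixed (the sum is the same for every `m₅` with
`|m₅| ≤ l₅`; here `m₅ = 0`), and the other projections are summed over.  The coefficient vanishes
unless all four triangle conditions hold, since then a factor vanishes in every term. -/
noncomputable def sixJ (l₁ l₂ l₃ l₄ l₅ l₆ : ℕ) : ℝ :=
  (-1 : ℝ) ^ (l₁ + l₂ + l₄ + l₅) / √((2 * l₃ + 1) * (2 * l₆ + 1)) *
    ∑ m₁ ∈ Finset.Icc (-(l₁ : ℤ)) l₁, ∑ m₂ ∈ Finset.Icc (-(l₂ : ℤ)) l₂,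
    ∑ m₃ ∈ Finset.Icc (-(l₃ : ℤ)) l₃, ∑ m₄ ∈ Finset.Icc (-(l₄ : ℤ)) l₄,
    ∑ m₆ ∈ Finset.Icc (-(l₆ : ℤ)) l₆,
      clebschGordan l₁ m₁ l₂ m₂ l₃ m₃ * clebschGordan l₁ m₁ l₆ m₆ l₅ 0 *
        clebschGordan l₃ m₃ l₄ m₄ l₅ 0 * clebschGordan l₂ m₂ l₄ m₄ l₆ m₆

/-!
Write `F_{a b}(m) = C_{a m b -m}^{l 0}`. The proof has two parts.

**Reduction to a pointwise bound.** The closed expression of the Clebsch-Gordan coefficients gives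
the ladder relations (`cg_raising`, `cg_lowering`), two symmetries (`cg_swap`, `cg_sq_exchange`) and
orthonormality. By Schur orthogonality of the two ways of coupling three angular momenta, the
product of `C_{l 0 l 0}^{s 0}` and a `6j` coefficient is, up to normalization, the coefficient of
the vector `H_j(m) = C_{l₁ m j -m}^{l 0} C_{j -m l 0}^{l₂ 0}` with respect to the orthonormal system
`m ↦ C_{l₁ m l₂ -m}^{s 0}` (`sum_recouplingRow_mul_cg`). So the sum over `s` is bounded, through
the inequalities of Cauchy-Schwarz and Bessel, by the product of the norms of `H_{j₁}` and
`H_{j₂}`. By the symmetries, `H_j(m) ^ 2` is a constant multiple of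
`F_{l₁ j}(m) ^ 2 * F_{l₂ j}(-m) ^ 2`. Hence the sum is at most the supremum of `|F_{a b}|` for any
choice of `a ∈ {l₁, l₂}` and `b ∈ {j₁, j₂}` (`sum_sixJ_le`); the choice of the larger ones gives the
theorem as soon as `|F_{a b}| ≤ c * (2 * min a b + 1) ^ (-1 / 5)`.

**The pointwise bound.** For `a ≤ b`, lowering and raising shows that `f = F_{a b}` satisfies a
three-term recurrence in `m` (`isThreeTermSolution_cg`). It is a discrete Sturm-Liouville equation
with turning points at `m ≈ ± h`, where `h` is the height over the side `√Z`, `Z = l (l + 1)`, of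
the triangle with the sides `√(a (a + 1))`, `√(b (b + 1))`, `√Z`. Its Sonin function `energy`, a
quadratic form in `f m` and `f (m + 1)`, has the exact decrement `2 m Z * f m ^ 2`
(`energy_sub_energy`), and dominates `Z * depth * f ^ 2`, where `depth = h ^ 2 - m (m + 1)`. A
telescoping second moment gives `energy 0 ≤ 3 Z h`. As `m` approaches the turning point, the energy
decreases at least like `depth ^ (2 / 5)` (`energy_pow_mul_le`), because an explicit modification
of `energy / depth ^ (2 / 5)` is monotone (`modifiedEnergy_succ_le`). This controls `f` up to a
transition region; there, either the decrement of the energy already bounds `f`, or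
`|f (m + 1)| - |f m|` is small (`abs_le_add_of_le`), and beyond the turning point `|f|` decreases.
The exponent `2 / 5` is just what is needed for `f ^ 2 ≤ C * a ^ (-2 / 5)`. When `l` is so small
that the analysis fails, the symmetry of the `3j` symbols gives the bound at once.
-/

/-! ### The Racah sum -/

theorem recipFactorial_of_neg {n : ℤ} (h : n < 0) : recipFactorial n = 0 := by
  simp [recipFactorial, not_le.mpr h]

theorem recipFactorial_natCast (n : ℕ) : recipFactorial n = 1 / (n ! : ℝ) := by
  simp [recipFactorial]

theorem nonneg_of_recipFactorial_ne_zero {n : ℤ} (h : recipFactorial n ≠ 0) : 0 ≤ n := by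
  by_contra hn
  exact h (recipFactorial_of_neg (not_le.mp hn))

theorem mul_recipFactorial (n : ℤ) : (n : ℝ) * recipFactorial n = recipFactorial (n - 1) := by
  rcases lt_trichotomy n 0 with h | rfl | h
  · rw [recipFactorial_of_neg h, recipFactorial_of_neg (by omega), mul_zero]
  · rw [recipFactorial_of_neg (n := 0 - 1) (by omega)]; simp
  · obtain ⟨k, rfl⟩ : ∃ k : ℕ, n = (k + 1 : ℕ) := ⟨(n - 1).toNat, by omega⟩
    have h1 : (((k + 1 : ℕ) : ℤ) - 1) = (k : ℕ) := by push_cast; ring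
    rw [h1, recipFactorial_natCast, recipFactorial_natCast, Nat.factorial_succ]
    have := Nat.factorial_ne_zero k
    push_cast
    field_simp

/-- The `k`-th term of the alternating sum in the closed expression of the Clebsch-Gordan
coefficient with `m = m₁ + m₂`. -/
noncomputable def racahTerm (l₁ l₂ l : ℕ) (m₁ m₂ : ℤ) (k : ℕ) : ℝ :=
  (-1 : ℝ) ^ k *
      (recipFactorial k * recipFactorial (l₁ + l₂ - l - k) *
        recipFactorial (l₁ - m₁ - k) * recipFactorial (l₂ + m₂ - k) *
        recipFactorial (l - l₂ + m₁ + k) * recipFactorial (l - l₁ - m₂ + k))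

/-- The alternating sum in the closed expression of the Clebsch-Gordan coefficient. -/
noncomputable def racahSum (l₁ l₂ l : ℕ) (m₁ m₂ : ℤ) : ℝ :=
  ∑ k ∈ Finset.range (l₁ + l₂ + 1), racahTerm l₁ l₂ l m₁ m₂ k

theorem racahTerm_support {l₁ l₂ l : ℕ} {m₁ m₂ : ℤ} {k : ℕ}
    (h : racahTerm l₁ l₂ l m₁ m₂ k ≠ 0) :
    (0 : ℤ) ≤ l₁ + l₂ - l - k ∧ 0 ≤ l₁ - m₁ - k ∧ 0 ≤ l₂ + m₂ - k ∧
      0 ≤ l - l₂ + m₁ + k ∧ 0 ≤ l - l₁ - m₂ + k := by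
  have h0 := right_ne_zero_of_mul h
  have h1 := left_ne_zero_of_mul h0
  have h2 := left_ne_zero_of_mul h1
  have h3 := left_ne_zero_of_mul h2
  have h4 := left_ne_zero_of_mul h3
  exact ⟨nonneg_of_recipFactorial_ne_zero (right_ne_zero_of_mul h4),
    nonneg_of_recipFactorial_ne_zero (right_ne_zero_of_mul h3),
    nonneg_of_recipFactorial_ne_zero (right_ne_zero_of_mul h2),
    nonneg_of_recipFactorial_ne_zero (right_ne_zero_of_mul h1),
    nonneg_of_recipFactorial_ne_zero (right_ne_zero_of_mul h0)⟩

/-- The Racah sum vanishes by itself outside the range of indices allowed for the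
Clebsch-Gordan coefficients. -/
theorem racahSum_support {l₁ l₂ l : ℕ} {m₁ m₂ : ℤ} (h : racahSum l₁ l₂ l m₁ m₂ ≠ 0) :
    |m₁| ≤ l₁ ∧ |m₂| ≤ l₂ ∧ |m₁ + m₂| ≤ l ∧ l ≤ l₁ + l₂ ∧ l₁ ≤ l₂ + l ∧ l₂ ≤ l₁ + l := by
  obtain ⟨k, -, hk⟩ := Finset.exists_ne_zero_of_sum_ne_zero h
  have := racahTerm_support hk
  simp only [abs_le]
  omega

/-- A telescoping sum whose terms cancel with an offset of one. -/
theorem sum_range_add_eq_zero_of_shift {n : ℕ} {P Q : ℕ → ℝ} (h0 : P 0 = 0) (hn : Q n = 0)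
    (h : ∀ k, P (k + 1) = -Q k) :
    ∑ k ∈ Finset.range (n + 1), (P k + Q k) = 0 := by
  rw [Finset.sum_add_distrib, Finset.sum_range_succ', Finset.sum_range_succ Q, h0, hn]
  simp [h]

/-- The contiguity relation behind the raising operator. Each coefficient on the right is split so
that its parts are absorbed by two of the reciprocal factorials of the `k`-th term; the unwanted
parts cancel against their neighbours. -/
theorem racahSum_raising (l₁ l₂ l : ℕ) (m₁ m₂ : ℤ) :
    ((l : ℝ) + m₁ + m₂) * racahSum l₁ l₂ l m₁ m₂ =
      ((l₁ : ℝ) - m₁ + 1) * racahSum l₁ l₂ l (m₁ - 1) m₂ +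
        ((l₂ : ℝ) - m₂ + 1) * racahSum l₁ l₂ l m₁ (m₂ - 1) := by
  -- the two remainders left over after splitting the coefficients `l₁ - m₁ + 1`, `l₂ - m₂ + 1`
  let P : ℕ → ℝ := fun k ↦ (-1 : ℝ) ^ k *
    (recipFactorial ((k : ℤ) - 1) * recipFactorial (l₁ + l₂ - l - k) *
      recipFactorial (l₁ - m₁ + 1 - k) * recipFactorial (l₂ + m₂ - k) *
      recipFactorial (l - l₂ + m₁ - 1 + k) * recipFactorial (l - l₁ - m₂ + k))
  let Q : ℕ → ℝ := fun k ↦ (-1 : ℝ) ^ k *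
    (recipFactorial k * recipFactorial (l₁ + l₂ - l - k - 1) *
      recipFactorial (l₁ - m₁ - k) * recipFactorial (l₂ + m₂ - 1 - k) *
      recipFactorial (l - l₂ + m₁ + k) * recipFactorial (l - l₁ - m₂ + 1 + k))
  have hPQ : ∑ k ∈ Finset.range (l₁ + l₂ + 1), (P k + Q k) = 0 := by
    apply sum_range_add_eq_zero_of_shift
    · simp only [P]; rw [recipFactorial_of_neg (by simp)]; simp
    · simp only [Q]
      rw [recipFactorial_of_neg (n := (l₁ : ℤ) + l₂ - l - (l₁ + l₂ : ℕ) - 1) (by omega)]; simp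
    · intro k
      simp only [P, Q, pow_succ]
      push_cast
      ring_nf
  have key : ∀ k : ℕ, ((l₁ : ℝ) - m₁ + 1) * racahTerm l₁ l₂ l (m₁ - 1) m₂ k +
      ((l₂ : ℝ) - m₂ + 1) * racahTerm l₁ l₂ l m₁ (m₂ - 1) k =
      ((l : ℝ) + m₁ + m₂) * racahTerm l₁ l₂ l m₁ m₂ k + (P k + Q k) := by
    intro k
    have e1 := mul_recipFactorial ((l₁ : ℤ) - m₁ + 1 - k)
    have e2 := mul_recipFactorial (k : ℤ)
    have e3 := mul_recipFactorial ((l : ℤ) - l₂ + m₁ + k)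
    have e4 := mul_recipFactorial ((l : ℤ) - l₁ - m₂ + 1 + k)
    have e5 := mul_recipFactorial ((l₁ : ℤ) + l₂ - l - k)
    have e6 := mul_recipFactorial ((l₂ : ℤ) + m₂ - k)
    rw [show (l₁ : ℤ) - m₁ + 1 - k - 1 = l₁ - m₁ - k by ring] at e1
    rw [show (l : ℤ) - l₂ + m₁ + k - 1 = l - l₂ + m₁ - 1 + k by ring] at e3
    rw [show (l : ℤ) - l₁ - m₂ + 1 + k - 1 = l - l₁ - m₂ + k by ring] at e4
    rw [show (l₂ : ℤ) + m₂ - k - 1 = l₂ + m₂ - 1 - k by ring] at e6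
    simp only [racahTerm, P, Q]
    rw [show (l₁ : ℤ) - (m₁ - 1) - k = l₁ - m₁ + 1 - k by ring,
      show (l : ℤ) - l₂ + (m₁ - 1) + k = l - l₂ + m₁ - 1 + k by ring,
      show (l : ℤ) - l₁ - (m₂ - 1) + k = l - l₁ - m₂ + 1 + k by ring,
      show (l₂ : ℤ) + (m₂ - 1) - k = l₂ + m₂ - 1 - k by ring, ← e1, ← e2, ← e3, ← e4, ← e5, ← e6]
    push_cast
    ring
  simp only [racahSum, Finset.mul_sum]
  rw [← Finset.sum_add_distrib, Finset.sum_congr rfl fun k _ ↦ key k, Finset.sum_add_distrib,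
    hPQ, add_zero]

/-- The contiguity relation behind the lowering operator. -/
theorem racahSum_lowering (l₁ l₂ l : ℕ) (m₁ m₂ : ℤ) :
    ((l : ℝ) - m₁ - m₂) * racahSum l₁ l₂ l m₁ m₂ =
      ((l₁ : ℝ) + m₁ + 1) * racahSum l₁ l₂ l (m₁ + 1) m₂ +
        ((l₂ : ℝ) + m₂ + 1) * racahSum l₁ l₂ l m₁ (m₂ + 1) := by
  -- the two remainders left over after splitting the coefficients `l₁ + m₁ + 1`, `l₂ + m₂ + 1`
  let Q : ℕ → ℝ := fun k ↦ (-1 : ℝ) ^ k *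
    (recipFactorial k * recipFactorial (l₁ + l₂ - l - k - 1) *
      recipFactorial (l₁ - m₁ - 1 - k) * recipFactorial (l₂ + m₂ - k) *
      recipFactorial (l - l₂ + m₁ + 1 + k) * recipFactorial (l - l₁ - m₂ + k))
  let P : ℕ → ℝ := fun k ↦ (-1 : ℝ) ^ k *
    (recipFactorial ((k : ℤ) - 1) * recipFactorial (l₁ + l₂ - l - k) *
      recipFactorial (l₁ - m₁ - k) * recipFactorial (l₂ + m₂ + 1 - k) *
      recipFactorial (l - l₂ + m₁ + k) * recipFactorial (l - l₁ - m₂ - 1 + k))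
  have hPQ : ∑ k ∈ Finset.range (l₁ + l₂ + 1), (P k + Q k) = 0 := by
    apply sum_range_add_eq_zero_of_shift
    · simp only [P]; rw [recipFactorial_of_neg (by simp)]; simp
    · simp only [Q]
      rw [recipFactorial_of_neg (n := (l₁ : ℤ) + l₂ - l - (l₁ + l₂ : ℕ) - 1) (by omega)]; simp
    · intro k
      simp only [P, Q, pow_succ]
      push_cast
      ring_nf
  have key : ∀ k : ℕ, ((l₁ : ℝ) + m₁ + 1) * racahTerm l₁ l₂ l (m₁ + 1) m₂ k +
      ((l₂ : ℝ) + m₂ + 1) * racahTerm l₁ l₂ l m₁ (m₂ + 1) k =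
      ((l : ℝ) - m₁ - m₂) * racahTerm l₁ l₂ l m₁ m₂ k + (P k + Q k) := by
    intro k
    have e1 := mul_recipFactorial ((l₁ : ℤ) - m₁ - k)
    have e2 := mul_recipFactorial (k : ℤ)
    have e3 := mul_recipFactorial ((l : ℤ) - l₂ + m₁ + 1 + k)
    have e4 := mul_recipFactorial ((l : ℤ) - l₁ - m₂ + k)
    have e5 := mul_recipFactorial ((l₁ : ℤ) + l₂ - l - k)
    have e6 := mul_recipFactorial ((l₂ : ℤ) + m₂ + 1 - k)
    rw [show (l₁ : ℤ) - m₁ - k - 1 = l₁ - m₁ - 1 - k by ring] at e1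
    rw [show (l : ℤ) - l₂ + m₁ + 1 + k - 1 = l - l₂ + m₁ + k by ring] at e3
    rw [show (l : ℤ) - l₁ - m₂ + k - 1 = l - l₁ - m₂ - 1 + k by ring] at e4
    rw [show (l₂ : ℤ) + m₂ + 1 - k - 1 = l₂ + m₂ - k by ring] at e6
    simp only [racahTerm, P, Q]
    rw [show (l₁ : ℤ) - (m₁ + 1) - k = l₁ - m₁ - 1 - k by ring,
      show (l : ℤ) - l₂ + (m₁ + 1) + k = l - l₂ + m₁ + 1 + k by ring,
      show (l : ℤ) - l₁ - (m₂ + 1) + k = l - l₁ - m₂ - 1 + k by ring,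
      show (l₂ : ℤ) + (m₂ + 1) - k = l₂ + m₂ + 1 - k by ring, ← e1, ← e2, ← e3, ← e4, ← e5, ← e6]
    push_cast
    ring
  simp only [racahSum, Finset.mul_sum]
  rw [← Finset.sum_add_distrib, Finset.sum_congr rfl fun k _ ↦ key k, Finset.sum_add_distrib,
    hPQ, add_zero]

/-! ### Ladder relations for the Clebsch-Gordan coefficients -/

/-- The matrix element `√((l - m)(l + m + 1))` of the ladder operators between the weights `m`
and `m + 1` of the representation of spin `l`; it is `0` when one of them is not a weight. -/
noncomputable def ladderCoeff (l : ℕ) (m : ℤ) : ℝ := √(((l : ℝ) - m) * (l + m + 1))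

/-- The Clebsch-Gordan coefficient with `m = m₁ + m₂`, as a function on `ℤ × ℤ`. -/
noncomputable def cg (l₁ l₂ l : ℕ) (m₁ m₂ : ℤ) : ℝ := clebschGordan l₁ m₁ l₂ m₂ l (m₁ + m₂)

theorem clebschGordan_eq_ite (l₁ : ℕ) (m₁ : ℤ) (l₂ : ℕ) (m₂ : ℤ) (l : ℕ) (m : ℤ) :
    clebschGordan l₁ m₁ l₂ m₂ l m = if m₁ + m₂ = m then cg l₁ l₂ l m₁ m₂ else 0 := by
  split_ifs with h
  · rw [cg, h]
  · simp [clebschGordan, h]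

/-- The triangle factor of the Clebsch-Gordan coefficient. -/
noncomputable def triangleFactor (l₁ l₂ l : ℕ) : ℝ :=
  √((2 * l + 1) * (l₁ + l₂ - l)! * (l₁ + l - l₂)! * (l₂ + l - l₁)! / (l₁ + l₂ + l + 1)!)

/-- The product `(l + m)! (l - m)!`, in the range `|m| ≤ l`. -/
noncomputable def weightFactor (l : ℕ) (m : ℤ) : ℝ := (l + m).toNat ! * (l - m).toNat !

theorem weightFactor_pos (l : ℕ) (m : ℤ) : 0 < weightFactor l m := by
  unfold weightFactor; positivity

theorem weightFactor_neg (l : ℕ) (m : ℤ) : weightFactor l (-m) = weightFactor l m := by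
  unfold weightFactor; rw [sub_neg_eq_add, ← sub_eq_add_neg, mul_comm]

theorem cg_eq (l₁ l₂ l : ℕ) (m₁ m₂ : ℤ) :
    cg l₁ l₂ l m₁ m₂ = triangleFactor l₁ l₂ l *
      (√(weightFactor l₁ m₁) * √(weightFactor l₂ m₂) * √(weightFactor l (m₁ + m₂))) *
        racahSum l₁ l₂ l m₁ m₂ := by
  by_cases h : racahSum l₁ l₂ l m₁ m₂ = 0
  · rw [h, mul_zero, cg, clebschGordan]
    split_ifs
    · change _ * _ * racahSum l₁ l₂ l m₁ m₂ = 0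
      rw [h, mul_zero]
    · rfl
  · have hs := racahSum_support h
    rw [cg, clebschGordan, if_pos ⟨hs.1, hs.2.1, hs.2.2.1, rfl, hs.2.2.2⟩]
    have e : √(((l₁ + m₁).toNat ! * (l₁ - m₁).toNat ! * (l₂ + m₂).toNat ! * (l₂ - m₂).toNat ! *
        (l + (m₁ + m₂)).toNat ! * (l - (m₁ + m₂)).toNat ! : ℝ)) =
        √(weightFactor l₁ m₁) * √(weightFactor l₂ m₂) * √(weightFactor l (m₁ + m₂)) := by
      have h1 := (weightFactor_pos l₁ m₁).le
      have h2 := (weightFactor_pos l₂ m₂).le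
      rw [← Real.sqrt_mul h1, ← Real.sqrt_mul (mul_nonneg h1 h2)]
      simp only [weightFactor, mul_assoc]
    rw [e]
    rfl

theorem cg_support {l₁ l₂ l : ℕ} {m₁ m₂ : ℤ} (h : cg l₁ l₂ l m₁ m₂ ≠ 0) :
    |m₁| ≤ l₁ ∧ |m₂| ≤ l₂ ∧ |m₁ + m₂| ≤ l ∧ l ≤ l₁ + l₂ ∧ l₁ ≤ l₂ + l ∧ l₂ ≤ l₁ + l := by
  rw [cg_eq] at h
  exact racahSum_support (right_ne_zero_of_mul h)

theorem ladderCoeff_self (l : ℕ) : ladderCoeff l l = 0 := by simp [ladderCoeff]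

theorem ladderCoeff_neg_sub_one (l : ℕ) : ladderCoeff l (-l - 1) = 0 := by
  unfold ladderCoeff; push_cast; ring_nf; simp

theorem ladderCoeff_neg (l : ℕ) (m : ℤ) : ladderCoeff l (-m) = ladderCoeff l (m - 1) := by
  unfold ladderCoeff; push_cast; congr 1; ring

theorem ladderCoeff_sq {l : ℕ} {m : ℤ} (h1 : -l - 1 ≤ m) (h2 : m ≤ l) :
    ladderCoeff l m ^ 2 = l * (l + 1) - m * (m + 1) := by
  have h1' : -(l : ℝ) - 1 ≤ m := by exact_mod_cast h1
  have h2' : (m : ℝ) ≤ l := by exact_mod_cast h2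
  rw [ladderCoeff, Real.sq_sqrt (mul_nonneg (by linarith) (by linarith))]
  ring

theorem ladderCoeff_mul_sqrt_weightFactor_succ {l : ℕ} {m : ℤ} (h : |m| ≤ l) (hm : m < l) :
    ladderCoeff l m * √(weightFactor l (m + 1)) = (l + m + 1) * √(weightFactor l m) := by
  rw [abs_le] at h
  obtain ⟨p, hp⟩ : ∃ p : ℕ, (l : ℤ) + m = p := ⟨(l + m).toNat, by omega⟩
  obtain ⟨q, hq⟩ : ∃ q : ℕ, (l : ℤ) - m = q + 1 := ⟨(l - m - 1).toNat, by omega⟩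
  have hp' : (l : ℝ) + m = p := by exact_mod_cast hp
  have hq' : (l : ℝ) - m = q + 1 := by exact_mod_cast hq
  have e : ((l : ℝ) - m) * (l + m + 1) * weightFactor l (m + 1) =
      (l + m + 1) ^ 2 * weightFactor l m := by
    unfold weightFactor
    rw [show (l : ℤ) + (m + 1) = (p + 1 : ℕ) by omega, show (l : ℤ) - (m + 1) = (q : ℕ) by omega,
      show (l : ℤ) + m = (p : ℕ) by omega, show (l : ℤ) - m = (q + 1 : ℕ) by omega]
    simp only [Int.toNat_natCast, Nat.factorial_succ]
    rw [hp', hq']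
    push_cast
    ring
  have hnn : 0 ≤ (l : ℝ) + m + 1 := by rw [hp']; positivity
  rw [ladderCoeff, ← Real.sqrt_mul (by rw [hp', hq']; positivity), e,
    Real.sqrt_mul (by positivity), Real.sqrt_sq hnn]

theorem ladderCoeff_mul_sqrt_weightFactor_pred {l : ℕ} {m : ℤ} (h : |m| ≤ l) (hm : -l < m) :
    ladderCoeff l (m - 1) * √(weightFactor l (m - 1)) = (l - m + 1) * √(weightFactor l m) := by
  have := ladderCoeff_mul_sqrt_weightFactor_succ (l := l) (m := -m) (by rwa [abs_neg]) (by omega)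
  rw [ladderCoeff_neg, show -m + 1 = -(m - 1) by ring, weightFactor_neg, weightFactor_neg] at this
  rw [this]; push_cast; ring

theorem cg_eq_zero_of_left {l₁ l₂ l : ℕ} {m₁ m₂ : ℤ} (h : ¬|m₁| ≤ l₁) : cg l₁ l₂ l m₁ m₂ = 0 := by
  by_contra h0; exact h (cg_support h0).1

theorem cg_eq_zero_of_right {l₁ l₂ l : ℕ} {m₁ m₂ : ℤ} (h : ¬|m₂| ≤ l₂) :
    cg l₁ l₂ l m₁ m₂ = 0 := by
  by_contra h0; exact h (cg_support h0).2.1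

theorem cg_eq_zero_of_add {l₁ l₂ l : ℕ} {m₁ m₂ : ℤ} (h : ¬|m₁ + m₂| ≤ l) :
    cg l₁ l₂ l m₁ m₂ = 0 := by
  by_contra h0; exact h (cg_support h0).2.2.1

theorem racahSum_eq_zero {l₁ l₂ l : ℕ} {m₁ m₂ : ℤ}
    (h : ¬(|m₁| ≤ l₁ ∧ |m₂| ≤ l₂ ∧ |m₁ + m₂| ≤ l)) : racahSum l₁ l₂ l m₁ m₂ = 0 := by
  by_contra h0
  have := racahSum_support h0
  exact h ⟨this.1, this.2.1, this.2.2.1⟩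

theorem ladderCoeff_mul_sqrt_succ_mul {l : ℕ} {m : ℤ} {x : ℝ} (h : |m| ≤ l)
    (hx : ¬|m + 1| ≤ l → x = 0) :
    ladderCoeff l m * √(weightFactor l (m + 1)) * x = (l + m + 1) * √(weightFactor l m) * x := by
  by_cases hm : m < l
  · rw [ladderCoeff_mul_sqrt_weightFactor_succ h hm]
  · rw [hx (by rw [abs_le]; omega)]; simp

theorem ladderCoeff_mul_sqrt_pred_mul {l : ℕ} {m : ℤ} {x : ℝ} (h : |m| ≤ l)
    (hx : ¬|m - 1| ≤ l → x = 0) :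
    ladderCoeff l (m - 1) * √(weightFactor l (m - 1)) * x =
      (l - m + 1) * √(weightFactor l m) * x := by
  by_cases hm : -l < m
  · rw [ladderCoeff_mul_sqrt_weightFactor_pred h hm]
  · rw [hx (by rw [abs_le]; omega)]; simp

/-- `ladderCoeff l m * x = 0` when `m` is not a weight and `x` vanishes unless `m + 1` is one. -/
theorem ladderCoeff_mul_eq_zero {l : ℕ} {m : ℤ} {x : ℝ} (h : ¬|m| ≤ l)
    (hx : ¬|m + 1| ≤ l → x = 0) : ladderCoeff l m * x = 0 := by
  by_cases hm : m = -l - 1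
  · rw [hm, ladderCoeff_neg_sub_one, zero_mul]
  · rw [hx (by rw [abs_le] at h ⊢; omega), mul_zero]

theorem ladderCoeff_sub_one_mul_eq_zero {l : ℕ} {m : ℤ} {x : ℝ} (h : ¬|m| ≤ l)
    (hx : ¬|m - 1| ≤ l → x = 0) : ladderCoeff l (m - 1) * x = 0 := by
  by_cases hm : m = l + 1
  · rw [hm, add_sub_cancel_right, ladderCoeff_self, zero_mul]
  · rw [hx (by rw [abs_le] at h ⊢; omega), mul_zero]

/-- The coupled vectors intertwine the lowering operators. -/
theorem cg_lowering (l₁ l₂ l : ℕ) (m₁ m₂ : ℤ) :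
    ladderCoeff l (m₁ + m₂) * cg l₁ l₂ l m₁ m₂ =
      ladderCoeff l₁ m₁ * cg l₁ l₂ l (m₁ + 1) m₂ + ladderCoeff l₂ m₂ * cg l₁ l₂ l m₁ (m₂ + 1) := by
  by_cases h1 : |m₁| ≤ l₁
  swap
  · rw [cg_eq_zero_of_left h1, cg_eq_zero_of_left (m₂ := m₂ + 1) h1,
      ladderCoeff_mul_eq_zero h1 cg_eq_zero_of_left]; simp
  by_cases h2 : |m₂| ≤ l₂
  swap
  · rw [cg_eq_zero_of_right h2, cg_eq_zero_of_right (m₁ := m₁ + 1) h2,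
      ladderCoeff_mul_eq_zero h2 cg_eq_zero_of_right]; simp
  by_cases h : |m₁ + m₂ + 1| ≤ l
  swap
  · rw [cg_eq_zero_of_add (m₁ := m₁ + 1) (by convert h using 3; ring),
      cg_eq_zero_of_add (m₂ := m₂ + 1) (by convert h using 3; ring)]
    have := ladderCoeff_sub_one_mul_eq_zero h (x := cg l₁ l₂ l m₁ m₂)
      (by rw [add_sub_cancel_right]; exact cg_eq_zero_of_add)
    rw [add_sub_cancel_right] at this
    rw [this]; simp
  have e0 := ladderCoeff_mul_sqrt_pred_mul h (x := racahSum l₁ l₂ l m₁ m₂)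
    (fun h' ↦ racahSum_eq_zero fun h0 ↦ h' (by rw [add_sub_cancel_right]; exact h0.2.2))
  have e1 := ladderCoeff_mul_sqrt_succ_mul h1 (x := racahSum l₁ l₂ l (m₁ + 1) m₂)
    (fun h' ↦ racahSum_eq_zero fun h0 ↦ h' h0.1)
  have e2 := ladderCoeff_mul_sqrt_succ_mul h2 (x := racahSum l₁ l₂ l m₁ (m₂ + 1))
    (fun h' ↦ racahSum_eq_zero fun h0 ↦ h' h0.2.1)
  have r := racahSum_lowering l₁ l₂ l m₁ m₂
  rw [add_sub_cancel_right] at e0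
  push_cast at e0
  rw [cg_eq, cg_eq, cg_eq, show m₁ + 1 + m₂ = m₁ + m₂ + 1 by ring,
    show m₁ + (m₂ + 1) = m₁ + m₂ + 1 by ring]
  generalize √(weightFactor l (m₁ + m₂ + 1)) = w at *
  generalize √(weightFactor l₁ m₁) = w1 at *
  generalize √(weightFactor l₂ m₂) = w2 at *
  linear_combination triangleFactor l₁ l₂ l * w1 * w2 * (e0 + w * r) -
    triangleFactor l₁ l₂ l * w2 * w * e1 - triangleFactor l₁ l₂ l * w1 * w * e2

/-- The coupled vectors intertwine the raising operators. -/
theorem cg_raising (l₁ l₂ l : ℕ) (m₁ m₂ : ℤ) :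
    ladderCoeff l (m₁ + m₂ - 1) * cg l₁ l₂ l m₁ m₂ =
      ladderCoeff l₁ (m₁ - 1) * cg l₁ l₂ l (m₁ - 1) m₂ +
        ladderCoeff l₂ (m₂ - 1) * cg l₁ l₂ l m₁ (m₂ - 1) := by
  by_cases h1 : |m₁| ≤ l₁
  swap
  · rw [cg_eq_zero_of_left h1, cg_eq_zero_of_left (m₂ := m₂ - 1) h1,
      ladderCoeff_sub_one_mul_eq_zero h1 cg_eq_zero_of_left]; simp
  by_cases h2 : |m₂| ≤ l₂
  swap
  · rw [cg_eq_zero_of_right h2, cg_eq_zero_of_right (m₁ := m₁ - 1) h2,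
      ladderCoeff_sub_one_mul_eq_zero h2 cg_eq_zero_of_right]; simp
  by_cases h : |m₁ + m₂ - 1| ≤ l
  swap
  · rw [cg_eq_zero_of_add (m₁ := m₁ - 1) (by convert h using 3; ring),
      cg_eq_zero_of_add (m₂ := m₂ - 1) (by convert h using 3; ring),
      ladderCoeff_mul_eq_zero h (by rw [sub_add_cancel]; exact cg_eq_zero_of_add)]
    simp
  have e0 := ladderCoeff_mul_sqrt_succ_mul h (x := racahSum l₁ l₂ l m₁ m₂)
    (fun h' ↦ racahSum_eq_zero fun h0 ↦ h' (by rw [sub_add_cancel]; exact h0.2.2))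
  have e1 := ladderCoeff_mul_sqrt_pred_mul h1 (x := racahSum l₁ l₂ l (m₁ - 1) m₂)
    (fun h' ↦ racahSum_eq_zero fun h0 ↦ h' h0.1)
  have e2 := ladderCoeff_mul_sqrt_pred_mul h2 (x := racahSum l₁ l₂ l m₁ (m₂ - 1))
    (fun h' ↦ racahSum_eq_zero fun h0 ↦ h' h0.2.1)
  have r := racahSum_raising l₁ l₂ l m₁ m₂
  rw [sub_add_cancel] at e0
  push_cast at e0
  rw [cg_eq, cg_eq, cg_eq, show m₁ - 1 + m₂ = m₁ + m₂ - 1 by ring,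
    show m₁ + (m₂ - 1) = m₁ + m₂ - 1 by ring]
  generalize √(weightFactor l (m₁ + m₂ - 1)) = w at *
  generalize √(weightFactor l₁ m₁) = w1 at *
  generalize √(weightFactor l₂ m₂) = w2 at *
  linear_combination triangleFactor l₁ l₂ l * w1 * w2 * (e0 + w * r) -
    triangleFactor l₁ l₂ l * w2 * w * e1 - triangleFactor l₁ l₂ l * w1 * w * e2

/-! ### Symmetries of the Clebsch-Gordan coefficients -/

/-- Exchanging the two spins and reversing the weights permutes the factors of each term of the
Racah sum. -/
theorem cg_swap (l₁ l₂ l : ℕ) (m₁ m₂ : ℤ) : cg l₁ l₂ l m₁ m₂ = cg l₂ l₁ l (-m₂) (-m₁) := by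
  have hr : racahSum l₁ l₂ l m₁ m₂ = racahSum l₂ l₁ l (-m₂) (-m₁) := by
    unfold racahSum
    rw [add_comm l₁ l₂]
    refine Finset.sum_congr rfl fun k _ ↦ ?_
    unfold racahTerm
    rw [add_comm (l₁ : ℤ) l₂, show (l₂ : ℤ) - -m₂ - k = l₂ + m₂ - k by ring,
      show (l₁ : ℤ) + -m₁ - k = l₁ - m₁ - k by ring,
      show (l : ℤ) - l₁ + -m₂ + k = l - l₁ - m₂ + k by ring,
      show (l : ℤ) - l₂ - -m₁ + k = l - l₂ + m₁ + k by ring]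
    ring
  have ht : triangleFactor l₁ l₂ l = triangleFactor l₂ l₁ l := by
    unfold triangleFactor
    rw [add_comm l₁ l₂]
    congr 1
    ring
  rw [cg_eq, cg_eq, hr, ht, show -m₂ + -m₁ = -(m₁ + m₂) by ring, weightFactor_neg,
    weightFactor_neg, weightFactor_neg]
  ring

theorem racahSum_eq_sum_range {l₁ l₂ l : ℕ} {m₁ m₂ : ℤ} {N : ℕ}
    (h : ∀ k, racahTerm l₁ l₂ l m₁ m₂ k ≠ 0 → k < N) :
    racahSum l₁ l₂ l m₁ m₂ = ∑ k ∈ Finset.range N, racahTerm l₁ l₂ l m₁ m₂ k := by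
  have key : ∀ n, (∀ k, racahTerm l₁ l₂ l m₁ m₂ k ≠ 0 → k < n) →
      ∑ k ∈ Finset.range n, racahTerm l₁ l₂ l m₁ m₂ k = ∑ᶠ k, racahTerm l₁ l₂ l m₁ m₂ k := by
    intro n hn
    rw [finsum_eq_sum_of_support_subset]
    intro k hk
    simpa using hn k hk
  rw [racahSum, key N h, key]
  intro k hk
  have := racahTerm_support hk
  omega

/-- Up to a sign, the Racah sum is invariant under the exchange of the second and the third
column of the corresponding `3j` symbol: reflect the summation index at `l₁ - m₁`. -/
theorem racahSum_exchange {l₁ l₂ l : ℕ} {m₁ m₂ : ℤ} (h : m₁ ≤ l₁) :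
    racahSum l₁ l l₂ m₁ (-(m₁ + m₂)) =
      (-1) ^ (l₁ - m₁).toNat * racahSum l₁ l₂ l m₁ m₂ := by
  obtain ⟨n, hn⟩ : ∃ n : ℕ, (l₁ : ℤ) - m₁ = n := ⟨(l₁ - m₁).toNat, by omega⟩
  rw [racahSum_eq_sum_range (N := n + 1), racahSum_eq_sum_range (N := n + 1),
    ← Finset.sum_range_reflect, Finset.mul_sum]
  · refine Finset.sum_congr rfl fun k hk ↦ ?_
    have hk' : k ≤ n := by simpa [Nat.lt_succ_iff] using hk
    obtain ⟨r, rfl⟩ := Nat.exists_eq_add_of_le hk'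
    rw [show k + r + 1 - 1 - k = r by omega, hn]
    have hm : m₁ = l₁ - k - r := by push_cast at hn; linarith
    subst hm
    simp only [racahTerm, Int.toNat_natCast]
    rw [show (l₁ : ℤ) + l - l₂ - r = l - l₂ + (l₁ - k - r) + k by ring,
      show (l₁ : ℤ) - (l₁ - k - r) - r = k by ring,
      show (l : ℤ) + -((l₁ - k - r) + m₂) - r = l - l₁ - m₂ + k by ring,
      show (l₂ : ℤ) - l + (l₁ - k - r) + r = l₁ + l₂ - l - k by ring,
      show (l₂ : ℤ) - l₁ - -((l₁ - k - r) + m₂) + r = l₂ + m₂ - k by ring,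
      show (l₁ : ℤ) - (l₁ - k - r) - k = r by ring, pow_add]
    have : ((-1 : ℝ) ^ k) * (-1) ^ k = 1 := by rw [← mul_pow]; simp
    linear_combination (-(-1 : ℝ) ^ r * (recipFactorial k * recipFactorial (l₁ + l₂ - l - k) *
        recipFactorial r * recipFactorial (l₂ + m₂ - k) *
        recipFactorial (l - l₂ + (l₁ - k - r) + k) * recipFactorial (l - l₁ - m₂ + k))) * this
  · intro k hk; have := racahTerm_support hk; omega
  · intro k hk; have := racahTerm_support hk; omega

theorem triangleFactor_sq (l₁ l₂ l : ℕ) :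
    triangleFactor l₁ l₂ l ^ 2 =
      (2 * l + 1) * (l₁ + l₂ - l)! * (l₁ + l - l₂)! * (l₂ + l - l₁)! / (l₁ + l₂ + l + 1)! := by
  rw [triangleFactor, Real.sq_sqrt (by positivity)]

theorem cg_sq (l₁ l₂ l : ℕ) (m₁ m₂ : ℤ) :
    cg l₁ l₂ l m₁ m₂ ^ 2 = triangleFactor l₁ l₂ l ^ 2 *
      (weightFactor l₁ m₁ * weightFactor l₂ m₂ * weightFactor l (m₁ + m₂)) *
        racahSum l₁ l₂ l m₁ m₂ ^ 2 := by
  rw [cg_eq]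
  simp only [mul_pow, Real.sq_sqrt (weightFactor_pos _ _).le]

/-- The symmetry of the `3j` symbols under the exchange of two columns, for the squares. -/
theorem cg_sq_exchange (l₁ l₂ l : ℕ) (m₁ m₂ : ℤ) :
    (2 * l₂ + 1) * cg l₁ l₂ l m₁ m₂ ^ 2 = (2 * l + 1) * cg l₁ l l₂ m₁ (-(m₁ + m₂)) ^ 2 := by
  by_cases h : m₁ ≤ l₁
  · rw [cg_sq, cg_sq, racahSum_exchange h, triangleFactor_sq, triangleFactor_sq,
      show m₁ + -(m₁ + m₂) = -m₂ by ring, weightFactor_neg, weightFactor_neg, mul_pow,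
      ← pow_mul, mul_comm _ 2, pow_mul, neg_one_sq, one_pow, add_right_comm l₁ l l₂,
      add_comm l l₂]
    ring
  · have h' : ¬|m₁| ≤ l₁ := fun h0 ↦ h (le_of_abs_le h0)
    rw [cg_eq_zero_of_left h', cg_eq_zero_of_left h']
    simp

/-! ### Orthogonality of coupled vectors -/

section Coupled

variable {G ι : Type*} [AddCommGroup G] [Fintype ι]

/-- A finitely supported function `u` on a group `G` of weight labels such that, for every `M`, its
restriction to the fibre `τ = M` is the vector of weight `M` in the standard basis of a copy of the
irreducible representation of spin `s`; `a i g` is the matrix element of the ladder operators of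
the `i`-th tensor factor between the labels `g` and `g + e i`. -/
structure IsCoupledVector (τ : G →+ ℤ) (e : ι → G) (a : ι → G → ℝ) (s : ℕ) (u : G → ℝ) :
    Prop where
  lowering : ∀ g, ladderCoeff s (τ g) * u g = ∑ i, a i g * u (g + e i)
  raising : ∀ g, ladderCoeff s (τ g - 1) * u g = ∑ i, a i (g - e i) * u (g - e i)
  finite : u.support.Finite

/-- The inner product of the parts of weight `M` of `u` and `v`. -/
noncomputable def weightPairing (τ : G →+ ℤ) (M : ℤ) (u v : G → ℝ) : ℝ :=
  ∑ᶠ g, if τ g = M then u g * v g else 0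

theorem weightPairing_comm (τ : G →+ ℤ) (M : ℤ) (u v : G → ℝ) :
    weightPairing τ M u v = weightPairing τ M v u := by
  simp only [weightPairing, mul_comm]

/-- The lowering and the raising operators are adjoint to each other. -/
theorem ladderCoeff_mul_weightPairing {τ : G →+ ℤ} {e : ι → G} (he : ∀ i, τ (e i) = 1)
    {a : ι → G → ℝ} {s t : ℕ} {u v : G → ℝ} (hu : IsCoupledVector τ e a s u)
    (hv : IsCoupledVector τ e a t v) (M : ℤ) :
    ladderCoeff s M * weightPairing τ M u v = ladderCoeff t M * weightPairing τ (M + 1) u v := by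
  unfold weightPairing
  rw [mul_finsum, mul_finsum]
  have h1 : ∀ g, (ladderCoeff s M * if τ g = M then u g * v g else 0) =
      ∑ i, if τ g = M then a i g * u (g + e i) * v g else 0 := by
    intro g
    split_ifs with h
    · rw [← mul_assoc, ← h, hu.lowering, Finset.sum_mul]
    · simp
  have h2 : ∀ g, (ladderCoeff t M * if τ g = M + 1 then u g * v g else 0) =
      ∑ i, if τ g = M + 1 then a i (g - e i) * u g * v (g - e i) else 0 := by
    intro g
    split_ifs with h
    · rw [mul_left_comm, show M = τ g - 1 by rw [h]; ring, hv.raising, Finset.mul_sum]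
      exact Finset.sum_congr rfl fun i _ ↦ by ring
    · simp
  simp only [h1, h2]
  rw [finsum_sum_comm, finsum_sum_comm]
  · refine Finset.sum_congr rfl fun i _ ↦ ?_
    rw [← finsum_comp_equiv (Equiv.subRight (e i))]
    refine finsum_congr fun g ↦ ?_
    simp [he, sub_eq_iff_eq_add]
  · intro i _
    refine hu.finite.subset fun g hg ↦ ?_
    simp only [Function.mem_support, ne_eq, ite_eq_right_iff, Classical.not_imp] at hg
    exact right_ne_zero_of_mul (left_ne_zero_of_mul hg.2)
  · intro i _
    refine hv.finite.subset fun g hg ↦ ?_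
    simp only [Function.mem_support, ne_eq, ite_eq_right_iff, Classical.not_imp] at hg
    exact right_ne_zero_of_mul hg.2

theorem ladderCoeff_zero_sq (l : ℕ) : ladderCoeff l 0 ^ 2 = l * (l + 1) := by
  rw [ladderCoeff_sq (by omega) (by omega)]; simp

/-- Coupled vectors of different spins are orthogonal. -/
theorem weightPairing_eq_zero {τ : G →+ ℤ} {e : ι → G} (he : ∀ i, τ (e i) = 1)
    {a : ι → G → ℝ} {s t : ℕ} {u v : G → ℝ} (hu : IsCoupledVector τ e a s u)
    (hv : IsCoupledVector τ e a t v) (hst : s ≠ t) : weightPairing τ 0 u v = 0 := by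
  have h1 := ladderCoeff_mul_weightPairing he hu hv 0
  have h2 := ladderCoeff_mul_weightPairing he hv hu 0
  rw [weightPairing_comm τ _ v u, weightPairing_comm τ _ v u] at h2
  have h3 : (ladderCoeff s 0 ^ 2 - ladderCoeff t 0 ^ 2) * weightPairing τ 0 u v = 0 := by
    linear_combination ladderCoeff s 0 * h1 - ladderCoeff t 0 * h2
  refine (mul_eq_zero.mp h3).resolve_left ?_
  rw [ladderCoeff_zero_sq, ladderCoeff_zero_sq]
  have h4 : (s : ℝ) * (s + 1) - t * (t + 1) = (s - t) * (s + t + 1) := by ring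
  rw [h4]
  refine mul_ne_zero (sub_ne_zero.mpr (by exact_mod_cast hst)) (by positivity)

end Coupled

/-! ### Orthonormality of the Clebsch-Gordan coefficients -/

/-- The total weight on `ℤ × ℤ`. -/
def totalWeight₂ : ℤ × ℤ →+ ℤ where
  toFun g := g.1 + g.2
  map_zero' := rfl
  map_add' g h := by simp only [Prod.fst_add, Prod.snd_add]; ring

theorem isCoupledVector_cg (l₁ l₂ l : ℕ) :
    IsCoupledVector totalWeight₂ ![(1, 0), (0, 1)]
      ![fun g ↦ ladderCoeff l₁ g.1, fun g ↦ ladderCoeff l₂ g.2] l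
      fun g ↦ cg l₁ l₂ l g.1 g.2 where
  lowering g := by
    simpa [totalWeight₂] using cg_lowering l₁ l₂ l g.1 g.2
  raising g := by
    simpa [totalWeight₂] using cg_raising l₁ l₂ l g.1 g.2
  finite := by
    refine (Finset.finite_toSet (Finset.Icc (-(l₁ : ℤ)) l₁ ×ˢ Finset.Icc (-(l₂ : ℤ)) l₂)).subset ?_
    intro g hg
    have := cg_support hg
    simp only [abs_le] at this
    simp [Prod.le_def, this.1, this.2.1]

theorem weightPairing_cg (l₁ l₂ l l' : ℕ) (M : ℤ) :
    weightPairing totalWeight₂ M (fun g ↦ cg l₁ l₂ l g.1 g.2) (fun g ↦ cg l₁ l₂ l' g.1 g.2) =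
      ∑ m ∈ Finset.Icc (-(l₁ : ℤ)) l₁, cg l₁ l₂ l m (M - m) * cg l₁ l₂ l' m (M - m) := by
  unfold weightPairing
  rw [finsum_eq_sum_of_support_subset (s := (Finset.Icc (-(l₁ : ℤ)) l₁).image fun m ↦ (m, M - m))]
  · rw [Finset.sum_image (fun _ _ _ _ h ↦ (Prod.ext_iff.mp h).1)]
    simp [totalWeight₂]
  · intro g hg
    simp only [Function.mem_support, ne_eq, ite_eq_right_iff, Classical.not_imp] at hg
    have h1 := (cg_support (left_ne_zero_of_mul hg.2)).1
    have h2 : g.1 + g.2 = M := hg.1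
    rw [abs_le] at h1
    simp only [Finset.coe_image, Finset.coe_Icc, Set.mem_image, Set.mem_Icc]
    exact ⟨g.1, h1, Prod.ext rfl (by simp [← h2])⟩

theorem sum_cg_mul_cg_eq_zero {l₁ l₂ l l' : ℕ} (h : l ≠ l') :
    ∑ m ∈ Finset.Icc (-(l₁ : ℤ)) l₁, cg l₁ l₂ l m (-m) * cg l₁ l₂ l' m (-m) = 0 := by
  have := weightPairing_cg l₁ l₂ l l' 0
  simp only [zero_sub] at this
  rw [← this]
  refine weightPairing_eq_zero ?_ (isCoupledVector_cg l₁ l₂ l) (isCoupledVector_cg l₁ l₂ l') h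
  intro i
  fin_cases i <;> rfl

/-- The Vandermonde convolution, from the expansions of the powers of `1 / (1 - X)`. -/
theorem sum_antidiagonal_choose_mul_choose (p q n : ℕ) :
    ∑ x ∈ Finset.HasAntidiagonal.antidiagonal n, (p + x.1).choose p * (q + x.2).choose q =
      (p + q + 1 + n).choose (p + q + 1) := by
  have h := congrArg (PowerSeries.coeff n) (pow_add (PowerSeries.mk (1 : ℕ → ℤ)) (p + 1) (q + 1))
  rw [show p + 1 + (q + 1) = p + q + 1 + 1 by ring, PowerSeries.mk_one_pow_eq_mk_choose_add,
    PowerSeries.mk_one_pow_eq_mk_choose_add, PowerSeries.mk_one_pow_eq_mk_choose_add,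
    PowerSeries.coeff_mul] at h
  simp only [PowerSeries.coeff_mk] at h
  exact_mod_cast h.symm

/-- For the highest weight `l` only the term `k = i` of the Racah sum is different from `0`. -/
theorem racahSum_top {l₁ l₂ l i j p q : ℕ} (hL : l + (i + j) = l₁ + l₂) (hp : p + l₂ = l₁ + l)
    (hq : q + l₁ = l₂ + l) :
    racahSum l₁ l₂ l (l₁ - i) (l - (l₁ - i)) =
      (-1) ^ i * (1 / ((i ! : ℝ) * j ! * p ! * q !)) := by
  rw [racahSum, Finset.sum_eq_single i]
  · unfold racahTerm
    rw [show (l₁ : ℤ) + l₂ - l - i = (j : ℕ) by omega, show (l₁ : ℤ) - (l₁ - i) - i = (0 : ℕ) by simp,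
      show (l₂ : ℤ) + (l - (l₁ - i)) - i = (q : ℕ) by omega,
      show (l : ℤ) - l₂ + (l₁ - i) + i = (p : ℕ) by omega,
      show (l : ℤ) - l₁ - (l - (l₁ - i)) + i = (0 : ℕ) by simp]
    simp only [recipFactorial_natCast]
    simp
    ring
  · intro k _ hk
    by_contra h
    have := racahTerm_support h
    omega
  · intro h
    exact absurd (Finset.mem_range.mpr (by omega)) h

theorem cg_sq_top {l₁ l₂ l i j p q : ℕ} (hL : l + (i + j) = l₁ + l₂) (hp : p + l₂ = l₁ + l)
    (hq : q + l₁ = l₂ + l) :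
    cg l₁ l₂ l (l₁ - i) (l - (l₁ - i)) ^ 2 =
      (((p + j).choose p * (q + i).choose q : ℕ) : ℝ) *
        ((p + q + 1)! * (i + j)! / (p + q + 1 + (i + j))! : ℝ) := by
  have hl : 2 * l = p + q := by omega
  have hl' : (2 : ℝ) * l = p + q := by exact_mod_cast hl
  have e1 : weightFactor l₁ (l₁ - i) = (p + j)! * i ! := by
    unfold weightFactor
    rw [show (l₁ : ℤ) + (l₁ - i) = (p + j : ℕ) by omega, show (l₁ : ℤ) - (l₁ - i) = (i : ℕ) by ring]
    simp only [Int.toNat_natCast]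
  have e2 : weightFactor l₂ (l - (l₁ - i)) = (q + i)! * j ! := by
    unfold weightFactor
    rw [show (l₂ : ℤ) + (l - (l₁ - i)) = (q + i : ℕ) by omega,
      show (l₂ : ℤ) - (l - (l₁ - i)) = (j : ℕ) by omega]
    simp only [Int.toNat_natCast]
  have e3 : weightFactor l (l₁ - i + (l - (l₁ - i))) = (p + q)! := by
    unfold weightFactor
    rw [show (l : ℤ) + (l₁ - i + (l - (l₁ - i))) = (p + q : ℕ) by omega,
      show (l : ℤ) - (l₁ - i + (l - (l₁ - i))) = (0 : ℕ) by omega]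
    simp only [Int.toNat_natCast, Nat.factorial_zero, Nat.cast_one, mul_one]
  rw [cg_sq, racahSum_top hL hp hq, triangleFactor_sq, e1, e2, e3,
    show l₁ + l₂ - l = i + j by omega, show l₁ + l - l₂ = p by omega,
    show l₂ + l - l₁ = q by omega, show l₁ + l₂ + l + 1 = p + q + 1 + (i + j) by omega,
    ← Nat.add_choose_mul_factorial_mul_factorial p j,
    ← Nat.add_choose_mul_factorial_mul_factorial q i, Nat.factorial_succ (p + q), hl', mul_pow,
    ← pow_mul, mul_comm i 2, pow_mul, neg_one_sq, one_pow]
  have hi := Nat.factorial_ne_zero i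
  have hj := Nat.factorial_ne_zero j
  have hpf := Nat.factorial_ne_zero p
  have hqf := Nat.factorial_ne_zero q
  have hN := Nat.factorial_ne_zero (p + q + 1 + (i + j))
  rw [Nat.choose_symm_add (a := p), Nat.choose_symm_add (a := q)]
  push_cast
  field_simp

theorem sum_cg_sq_top {l₁ l₂ l : ℕ} (h : l ≤ l₁ + l₂) (h1 : l₁ ≤ l₂ + l) (h2 : l₂ ≤ l₁ + l) :
    ∑ m ∈ Finset.Icc (-(l₁ : ℤ)) l₁, cg l₁ l₂ l m (l - m) ^ 2 = 1 := by
  obtain ⟨L, hL⟩ := Nat.exists_eq_add_of_le h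
  obtain ⟨p, hp⟩ := Nat.exists_eq_add_of_le h2
  obtain ⟨q, hq⟩ := Nat.exists_eq_add_of_le h1
  have key : ∑ x ∈ Finset.HasAntidiagonal.antidiagonal L,
      (((p + x.1).choose p * (q + x.2).choose q : ℕ) : ℝ) *
        ((p + q + 1)! * L ! / (p + q + 1 + L)! : ℝ) =
      ∑ m ∈ Finset.Icc (-(l₁ : ℤ)) l₁, cg l₁ l₂ l m (l - m) ^ 2 := by
    refine Finset.sum_of_injOn (fun x ↦ (l₁ : ℤ) - x.2) ?_ ?_ ?_ ?_
    · intro x hx y hy hxy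
      simp only [Finset.mem_coe, Finset.HasAntidiagonal.mem_antidiagonal] at hx hy
      simp only [sub_right_inj, Nat.cast_inj] at hxy
      exact Prod.ext (by omega) hxy
    · intro x hx
      simp only [Finset.mem_coe, Finset.HasAntidiagonal.mem_antidiagonal, Finset.mem_Icc] at hx ⊢
      omega
    · intro m hm hx
      rw [Finset.mem_Icc] at hm
      have : ¬|(l : ℤ) - m| ≤ l₂ := by
        intro h0
        rw [abs_le] at h0
        refine hx ⟨(L - (l₁ - m).toNat, (l₁ - m).toNat), ?_, ?_⟩
        · simp only [Finset.mem_coe, Finset.HasAntidiagonal.mem_antidiagonal]; omega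
        · simp only; omega
      rw [cg_eq_zero_of_right this]; simp
    · intro x hx
      rw [Finset.HasAntidiagonal.mem_antidiagonal] at hx
      rw [cg_sq_top (i := x.2) (j := x.1) (p := p) (q := q) (by omega) (by omega) (by omega),
        add_comm x.2, hx]
  rw [← key, ← Finset.sum_mul, ← Nat.cast_sum, sum_antidiagonal_choose_mul_choose]
  have := Nat.add_choose_mul_factorial_mul_factorial (p + q + 1) L
  rw [← this]
  have h1 := Nat.factorial_ne_zero (p + q + 1)
  have h2 := Nat.factorial_ne_zero L
  have h3 : (p + q + 1 + L).choose (p + q + 1) ≠ 0 := (Nat.choose_pos (by omega)).ne'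
  rw [← Nat.choose_symm_add (a := p + q + 1)]
  push_cast
  field_simp

theorem ladderCoeff_pos {l : ℕ} {m : ℤ} (h1 : -l ≤ m) (h2 : m < l) : 0 < ladderCoeff l m := by
  have h1' : -(l : ℝ) ≤ m := by exact_mod_cast h1
  have h2' : (m : ℝ) < l := by exact_mod_cast h2
  exact Real.sqrt_pos.mpr (mul_pos (by linarith) (by linarith))

/-- The coupled vectors of a fixed weight are normalized: the norm does not depend on the weight,
and for the highest one it is given by a Vandermonde convolution. -/
theorem sum_cg_sq {l₁ l₂ l : ℕ} (h : l ≤ l₁ + l₂) (h1 : l₁ ≤ l₂ + l) (h2 : l₂ ≤ l₁ + l)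
    {M : ℤ} (hM : |M| ≤ l) :
    ∑ m ∈ Finset.Icc (-(l₁ : ℤ)) l₁, cg l₁ l₂ l m (M - m) ^ 2 = 1 := by
  obtain ⟨n, hn⟩ : ∃ n : ℕ, M = l - n := ⟨(l - M).toNat, by rw [abs_le] at hM; omega⟩
  induction n generalizing M with
  | zero => rw [hn]; simpa using sum_cg_sq_top h h1 h2
  | succ n ih =>
    rw [abs_le] at hM
    have h3 := ih (M := M + 1) (by rw [abs_le]; omega) (by omega)
    have h4 := ladderCoeff_mul_weightPairing (e := ![((1 : ℤ), (0 : ℤ)), (0, 1)])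
      (fun i ↦ by fin_cases i <;> rfl) (isCoupledVector_cg l₁ l₂ l) (isCoupledVector_cg l₁ l₂ l) M
    rw [weightPairing_cg, weightPairing_cg] at h4
    have h5 := mul_left_cancel₀ (ladderCoeff_pos (l := l) (m := M) (by omega) (by omega)).ne' h4
    simp only [← pow_two] at h5
    rw [h5, h3]

theorem sum_cg_sq_le_one (l₁ l₂ l : ℕ) (M : ℤ) :
    ∑ m ∈ Finset.Icc (-(l₁ : ℤ)) l₁, cg l₁ l₂ l m (M - m) ^ 2 ≤ 1 := by
  by_cases h : |M| ≤ l ∧ l ≤ l₁ + l₂ ∧ l₁ ≤ l₂ + l ∧ l₂ ≤ l₁ + l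
  · exact (sum_cg_sq h.2.1 h.2.2.1 h.2.2.2 h.1).le
  · rw [Finset.sum_eq_zero]
    · exact zero_le_one
    · intro m _
      by_contra h0
      have := cg_support (ne_zero_pow two_ne_zero h0)
      rw [add_sub_cancel] at this
      exact h this.2.2

theorem cg_sq_le_one (l₁ l₂ l : ℕ) (m₁ m₂ : ℤ) : cg l₁ l₂ l m₁ m₂ ^ 2 ≤ 1 := by
  by_cases h : |m₁| ≤ l₁
  · have := sum_cg_sq_le_one l₁ l₂ l (m₁ + m₂)
    refine le_trans ?_ this
    have h1 := Finset.single_le_sum (f := fun m ↦ cg l₁ l₂ l m (m₁ + m₂ - m) ^ 2)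
      (s := Finset.Icc (-(l₁ : ℤ)) l₁) (fun _ _ ↦ sq_nonneg _)
      (Finset.mem_Icc.mpr (abs_le.mp h))
    simpa using h1
  · rw [cg_eq_zero_of_left h]; norm_num

/-! ### Recoupling of three angular momenta -/

/-- The total weight on `ℤ × ℤ × ℤ`. -/
def totalWeight₃ : ℤ × ℤ × ℤ →+ ℤ where
  toFun g := g.1 + g.2.1 + g.2.2
  map_zero' := rfl
  map_add' g h := by simp only [Prod.fst_add, Prod.snd_add]; ring

/-- The unit vectors of `ℤ × ℤ × ℤ`. -/
def unitStep₃ : Fin 3 → ℤ × ℤ × ℤ := ![(1, 0, 0), (0, 1, 0), (0, 0, 1)]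

theorem totalWeight₃_unitStep₃ (i : Fin 3) : totalWeight₃ (unitStep₃ i) = 1 := by
  fin_cases i <;> rfl

/-- The matrix elements of the ladder operators on a product of three irreducible
representations. -/
noncomputable def ladderCoeff₃ (l₁ l₂ l₃ : ℕ) : Fin 3 → ℤ × ℤ × ℤ → ℝ :=
  ![fun g ↦ ladderCoeff l₁ g.1, fun g ↦ ladderCoeff l₂ g.2.1, fun g ↦ ladderCoeff l₃ g.2.2]

/-- The vectors of spin `s` obtained by coupling `l₁` and `l₂` to `l₁₂`, and this to `l₃`. -/
noncomputable def leftCoupled (l₁ l₂ l₃ l₁₂ s : ℕ) (g : ℤ × ℤ × ℤ) : ℝ :=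
  cg l₁ l₂ l₁₂ g.1 g.2.1 * cg l₁₂ l₃ s (g.1 + g.2.1) g.2.2

/-- The vectors of spin `s` obtained by coupling `l₁` to the result `l₂₃` of coupling `l₂`
and `l₃`. -/
noncomputable def rightCoupled (l₁ l₂ l₃ l₂₃ s : ℕ) (g : ℤ × ℤ × ℤ) : ℝ :=
  cg l₂ l₃ l₂₃ g.2.1 g.2.2 * cg l₁ l₂₃ s g.1 (g.2.1 + g.2.2)

theorem isCoupledVector_leftCoupled (l₁ l₂ l₃ l₁₂ s : ℕ) :
    IsCoupledVector totalWeight₃ unitStep₃ (ladderCoeff₃ l₁ l₂ l₃) s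
      (leftCoupled l₁ l₂ l₃ l₁₂ s) where
  lowering := by
    rintro ⟨a, b, c⟩
    have h1 := cg_lowering l₁ l₂ l₁₂ a b
    have h2 := cg_lowering l₁₂ l₃ s (a + b) c
    simp only [Fin.sum_univ_three, leftCoupled, ladderCoeff₃, unitStep₃, totalWeight₃]
    simp only [AddMonoidHom.coe_mk, ZeroHom.coe_mk, Matrix.cons_val_zero, Matrix.cons_val_one,
      Matrix.cons_val, Prod.mk_add_mk, add_zero]
    rw [show a + 1 + b = a + b + 1 by ring, show a + (b + 1) = a + b + 1 by ring]
    linear_combination cg l₁ l₂ l₁₂ a b * h2 + cg l₁₂ l₃ s (a + b + 1) c * h1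
  raising := by
    rintro ⟨a, b, c⟩
    have h1 := cg_raising l₁ l₂ l₁₂ a b
    have h2 := cg_raising l₁₂ l₃ s (a + b) c
    simp only [Fin.sum_univ_three, leftCoupled, ladderCoeff₃, unitStep₃, totalWeight₃]
    simp only [AddMonoidHom.coe_mk, ZeroHom.coe_mk, Matrix.cons_val_zero, Matrix.cons_val_one,
      Matrix.cons_val, Prod.mk_sub_mk, sub_zero]
    rw [show a - 1 + b = a + b - 1 by ring, show a + (b - 1) = a + b - 1 by ring]
    linear_combination cg l₁ l₂ l₁₂ a b * h2 + cg l₁₂ l₃ s (a + b - 1) c * h1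
  finite := by
    refine (Finset.finite_toSet (Finset.Icc (-(l₁ : ℤ)) l₁ ×ˢ Finset.Icc (-(l₂ : ℤ)) l₂ ×ˢ
      Finset.Icc (-(l₃ : ℤ)) l₃)).subset ?_
    intro g hg
    have h1 := cg_support (left_ne_zero_of_mul hg)
    have h2 := cg_support (right_ne_zero_of_mul hg)
    simp only [abs_le] at h1 h2
    simp only [Finset.coe_product, Set.mem_prod, Finset.coe_Icc, Set.mem_Icc]
    exact ⟨h1.1, h1.2.1, h2.2.1⟩

theorem isCoupledVector_rightCoupled (l₁ l₂ l₃ l₂₃ s : ℕ) :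
    IsCoupledVector totalWeight₃ unitStep₃ (ladderCoeff₃ l₁ l₂ l₃) s
      (rightCoupled l₁ l₂ l₃ l₂₃ s) where
  lowering := by
    rintro ⟨a, b, c⟩
    have h1 := cg_lowering l₂ l₃ l₂₃ b c
    have h2 := cg_lowering l₁ l₂₃ s a (b + c)
    simp only [Fin.sum_univ_three, rightCoupled, ladderCoeff₃, unitStep₃, totalWeight₃]
    simp only [AddMonoidHom.coe_mk, ZeroHom.coe_mk, Matrix.cons_val_zero, Matrix.cons_val_one,
      Matrix.cons_val, Prod.mk_add_mk, add_zero]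
    rw [← add_assoc] at h2
    rw [show b + 1 + c = b + c + 1 by ring, show b + (c + 1) = b + c + 1 by ring]
    linear_combination cg l₂ l₃ l₂₃ b c * h2 + cg l₁ l₂₃ s a (b + c + 1) * h1
  raising := by
    rintro ⟨a, b, c⟩
    have h1 := cg_raising l₂ l₃ l₂₃ b c
    have h2 := cg_raising l₁ l₂₃ s a (b + c)
    simp only [Fin.sum_univ_three, rightCoupled, ladderCoeff₃, unitStep₃, totalWeight₃]
    simp only [AddMonoidHom.coe_mk, ZeroHom.coe_mk, Matrix.cons_val_zero, Matrix.cons_val_one,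
      Matrix.cons_val, Prod.mk_sub_mk, sub_zero]
    rw [← add_assoc] at h2
    rw [show b - 1 + c = b + c - 1 by ring, show b + (c - 1) = b + c - 1 by ring]
    linear_combination cg l₂ l₃ l₂₃ b c * h2 + cg l₁ l₂₃ s a (b + c - 1) * h1
  finite := by
    refine (Finset.finite_toSet (Finset.Icc (-(l₁ : ℤ)) l₁ ×ˢ Finset.Icc (-(l₂ : ℤ)) l₂ ×ˢ
      Finset.Icc (-(l₃ : ℤ)) l₃)).subset ?_
    intro g hg
    have h1 := cg_support (left_ne_zero_of_mul hg)
    have h2 := cg_support (right_ne_zero_of_mul hg)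
    simp only [abs_le] at h1 h2
    simp only [Finset.coe_product, Set.mem_prod, Finset.coe_Icc, Set.mem_Icc]
    exact ⟨h2.1, h1.1, h1.2.1⟩

/-- The overlap of the two ways of coupling three angular momenta, in weight `0`. -/
noncomputable def recoupling (l₁ l₂ l₃ l₁₂ l₂₃ s t : ℕ) : ℝ :=
  ∑ m₁ ∈ Finset.Icc (-(l₁ : ℤ)) l₁, ∑ m₂ ∈ Finset.Icc (-(l₂ : ℤ)) l₂,
    leftCoupled l₁ l₂ l₃ l₁₂ s (m₁, m₂, -(m₁ + m₂)) *
      rightCoupled l₁ l₂ l₃ l₂₃ t (m₁, m₂, -(m₁ + m₂))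

theorem recoupling_eq_zero {l₁ l₂ l₃ l₁₂ l₂₃ s t : ℕ} (hst : s ≠ t) :
    recoupling l₁ l₂ l₃ l₁₂ l₂₃ s t = 0 := by
  rw [← weightPairing_eq_zero totalWeight₃_unitStep₃
    (isCoupledVector_leftCoupled l₁ l₂ l₃ l₁₂ s) (isCoupledVector_rightCoupled l₁ l₂ l₃ l₂₃ t) hst]
  unfold weightPairing recoupling
  rw [← Finset.sum_product', finsum_eq_sum_of_support_subset
    (s := (Finset.Icc (-(l₁ : ℤ)) l₁ ×ˢ Finset.Icc (-(l₂ : ℤ)) l₂).image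
      fun p ↦ (p.1, p.2, -(p.1 + p.2)))]
  · rw [Finset.sum_image]
    · simp [totalWeight₃]
    · intro p _ q _ h
      simp only [Prod.mk.injEq] at h
      exact Prod.ext h.1 h.2.1
  · rintro ⟨a, b, c⟩ hg
    simp only [Function.mem_support, ne_eq, ite_eq_right_iff, Classical.not_imp] at hg
    have h1 := cg_support (left_ne_zero_of_mul (left_ne_zero_of_mul hg.2))
    have h2 : a + b + c = 0 := hg.1
    simp only [abs_le] at h1
    simp only [Finset.coe_image, Finset.coe_product, Finset.coe_Icc, Set.mem_image, Set.mem_prod,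
      Set.mem_Icc, Prod.mk.injEq, Prod.exists]
    exact ⟨a, b, ⟨h1.1, h1.2.1⟩, rfl, rfl, by omega⟩

/-- The selection rules leave only two of the five summations. -/
theorem sixJ_eq_recoupling (l₁ l₂ l₃ l₄ l₅ l₆ : ℕ) :
    sixJ l₁ l₂ l₃ l₄ l₅ l₆ = (-1 : ℝ) ^ (l₁ + l₂ + l₄ + l₅) / √((2 * l₃ + 1) * (2 * l₆ + 1)) *
      recoupling l₁ l₂ l₄ l₃ l₆ l₅ l₅ := by
  unfold sixJ recoupling
  congr 1
  refine Finset.sum_congr rfl fun m₁ _ ↦ Finset.sum_congr rfl fun m₂ _ ↦ ?_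
  simp only [clebschGordan_eq_ite, leftCoupled, rightCoupled]
  rw [Finset.sum_eq_single (m₁ + m₂), Finset.sum_eq_single (-(m₁ + m₂)),
    Finset.sum_eq_single (m₂ + -(m₁ + m₂))]
  · rw [if_pos rfl, if_pos (by ring), if_pos (by ring), if_pos rfl]
    ring
  · intro m₆ _ h
    rw [if_neg (Ne.symm h)]; simp
  · intro h
    rw [cg_eq_zero_of_add (l₁ := l₂) (by rwa [abs_le, ← Finset.mem_Icc])]; simp
  · intro m₄ _ h
    refine Finset.sum_eq_zero fun m₆ _ ↦ ?_
    rw [if_neg (c := _ + m₄ = 0) (by omega)]; simp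
  · intro h
    refine Finset.sum_eq_zero fun m₆ _ ↦ ?_
    rw [cg_eq_zero_of_right (l₁ := l₃) (by rwa [abs_le, ← Finset.mem_Icc])]; simp
  · intro m₃ _ h
    refine Finset.sum_eq_zero fun m₄ _ ↦ Finset.sum_eq_zero fun m₆ _ ↦ ?_
    rw [if_neg (c := m₁ + m₂ = m₃) (Ne.symm h)]; simp
  · intro h
    refine Finset.sum_eq_zero fun m₄ _ ↦ Finset.sum_eq_zero fun m₆ _ ↦ ?_
    rw [cg_eq_zero_of_add (l₁ := l₁) (by rwa [abs_le, ← Finset.mem_Icc])]; simp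

/-- The vectors of weight `0` in the square of the representation of spin `l` are spanned by the
coupled ones. -/
theorem sum_cg_zero_mul_cg (l : ℕ) {m : ℤ} (hm : |m| ≤ l) :
    ∑ s ∈ Finset.range (2 * l + 1), cg l l s 0 0 * cg l l s m (-m) = if m = 0 then 1 else 0 := by
  obtain ⟨Q, hQa⟩ : ∃ Q : Matrix (Fin (2 * l + 1)) (Fin (2 * l + 1)) ℝ,
      ∀ s i, Q s i = cg l l s ((i : ℤ) - l) (-((i : ℤ) - l)) := ⟨Matrix.of _, fun _ _ ↦ rfl⟩
  have hsum : ∀ F : ℤ → ℝ, ∑ i : Fin (2 * l + 1), F ((i : ℤ) - l) =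
      ∑ m ∈ Finset.Icc (-(l : ℤ)) l, F m := by
    intro F
    refine Finset.sum_bij (fun i _ ↦ (i : ℤ) - l) ?_ ?_ ?_ ?_
    · intro i _; rw [Finset.mem_Icc]; have := i.2; omega
    · intro i _ j _ h; exact Fin.ext (by omega)
    · intro m hm
      rw [Finset.mem_Icc] at hm
      exact ⟨⟨(m + l).toNat, by omega⟩, Finset.mem_univ _, by simp only; omega⟩
    · intro i _; rfl
  have hQ : Q * Q.transpose = 1 := by
    ext s t
    rw [Matrix.mul_apply]
    simp only [Matrix.transpose_apply, hQa]
    rw [hsum fun m ↦ cg l l s m (-m) * cg l l t m (-m)]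
    by_cases hst : s = t
    · subst hst
      have := sum_cg_sq (l₁ := l) (l₂ := l) (l := s) (M := 0) (by have := s.2; omega) (by omega)
        (by omega) (by simp)
      simpa [pow_two] using this
    · rw [sum_cg_mul_cg_eq_zero (fun h ↦ hst (Fin.ext h)), Matrix.one_apply_ne hst]
  have hQ' := mul_eq_one_comm.mp hQ
  rw [abs_le] at hm
  have h0 := congrFun (congrFun hQ' ⟨l, by omega⟩) ⟨(m + l).toNat, by omega⟩
  rw [Matrix.mul_apply] at h0
  have hm' : (((m + l).toNat : ℕ) : ℤ) - l = m := by omega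
  simp only [Matrix.transpose_apply, hQa, hm', sub_self, neg_zero] at h0
  rw [Fin.sum_univ_eq_sum_range fun s ↦ cg l l s 0 0 * cg l l s m (-m)] at h0
  rw [h0, Matrix.one_apply]
  refine if_congr ?_ rfl rfl
  rw [Fin.mk.injEq]
  omega

/-- Take `l₁` and `j` coupled to spin `l` and weight `0`, beside a third spin `l` of weight `0`, and
project to the subspace in which `j` and the third spin are coupled to `l₂`. This is the component
with weight `m` of `l₁`. -/
noncomputable def recouplingRow (l₁ j l l₂ : ℕ) (m : ℤ) : ℝ :=
  cg l₁ j l m (-m) * cg j l l₂ (-m) 0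

/-- By orthogonality the right side is the sum over all `t` of `C_{l 0 l 0}^{t 0}` times the overlap
of left coupled vectors of spin `t` with right coupled ones of spin `s`; completeness of the coupled
vectors of weight `0` evaluates the sum over `t`. -/
theorem sum_recouplingRow_mul_cg {l₁ j l l₂ s : ℕ} (hs : s ≤ 2 * l) :
    ∑ m ∈ Finset.Icc (-(l₁ : ℤ)) l₁, recouplingRow l₁ j l l₂ m * cg l₁ l₂ s m (-m) =
      cg l l s 0 0 * recoupling l₁ j l l l₂ s s := by
  have h1 : cg l l s 0 0 * recoupling l₁ j l l l₂ s s =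
      ∑ t ∈ Finset.range (2 * l + 1), cg l l t 0 0 * recoupling l₁ j l l l₂ t s := by
    rw [Finset.sum_eq_single s]
    · intro t _ h; rw [recoupling_eq_zero h, mul_zero]
    · intro h; exact absurd (Finset.mem_range.mpr (by omega)) h
  rw [h1]
  simp only [recoupling, Finset.mul_sum]
  rw [Finset.sum_comm]
  refine Finset.sum_congr rfl fun m₁ _ ↦ ?_
  rw [Finset.sum_comm]
  have h2 : ∀ m₂ : ℤ, ∑ t ∈ Finset.range (2 * l + 1), cg l l t 0 0 *
      (leftCoupled l₁ j l l t (m₁, m₂, -(m₁ + m₂)) *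
        rightCoupled l₁ j l l₂ s (m₁, m₂, -(m₁ + m₂))) =
      if m₂ = -m₁ then recouplingRow l₁ j l l₂ m₁ * cg l₁ l₂ s m₁ (-m₁) else 0 := by
    intro m₂
    by_cases h : |m₁ + m₂| ≤ l
    · have h3 := sum_cg_zero_mul_cg l h
      calc _ = (∑ t ∈ Finset.range (2 * l + 1), cg l l t 0 0 * cg l l t (m₁ + m₂) (-(m₁ + m₂))) *
            (cg l₁ j l m₁ m₂ * rightCoupled l₁ j l l₂ s (m₁, m₂, -(m₁ + m₂))) := by
            rw [Finset.sum_mul]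
            refine Finset.sum_congr rfl fun t _ ↦ ?_
            simp only [leftCoupled]
            ring
        _ = _ := by
            rw [h3]
            by_cases h4 : m₂ = -m₁
            · subst h4; simp [recouplingRow, rightCoupled]; ring
            · rw [if_neg h4, if_neg (by omega), zero_mul]
    · rw [if_neg (by rintro rfl; simp at h)]
      refine Finset.sum_eq_zero fun t _ ↦ ?_
      simp only [leftCoupled]
      rw [cg_eq_zero_of_add h]; simp
  simp only [h2]
  rw [Finset.sum_ite_eq']
  split_ifs with h
  · rfl
  · rw [recouplingRow, cg_eq_zero_of_right (m₂ := -m₁) (by rwa [abs_le, ← Finset.mem_Icc])]; simp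

/-- Bessel's inequality for an orthogonal family of vectors of norm at most `1`. -/
theorem sum_sq_sum_mul_le {α β : Type*} [DecidableEq β] (A : Finset α) (B : Finset β)
    (x : β → α → ℝ)
    (hx : ∀ s ∈ B, ∀ t ∈ B, s ≠ t → ∑ m ∈ A, x s m * x t m = 0)
    (hx1 : ∀ s ∈ B, ∑ m ∈ A, x s m ^ 2 ≤ 1) (H : α → ℝ) :
    ∑ s ∈ B, (∑ m ∈ A, H m * x s m) ^ 2 ≤ ∑ m ∈ A, H m ^ 2 := by
  set c : β → ℝ := fun s ↦ ∑ m ∈ A, H m * x s m with hc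
  have h1 : ∑ m ∈ A, H m * ∑ s ∈ B, c s * x s m = ∑ s ∈ B, c s ^ 2 := by
    simp only [Finset.mul_sum]
    rw [Finset.sum_comm]
    refine Finset.sum_congr rfl fun s _ ↦ ?_
    rw [pow_two]
    nth_rewrite 2 [hc]
    rw [Finset.mul_sum]
    exact Finset.sum_congr rfl fun m _ ↦ by ring
  have h2 : ∑ m ∈ A, (∑ s ∈ B, c s * x s m) ^ 2 ≤ ∑ s ∈ B, c s ^ 2 := by
    have h3 : ∀ m, (∑ s ∈ B, c s * x s m) ^ 2 =
        ∑ s ∈ B, ∑ t ∈ B, c s * c t * (x s m * x t m) := by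
      intro m
      rw [pow_two, Finset.sum_mul_sum]
      exact Finset.sum_congr rfl fun s _ ↦ Finset.sum_congr rfl fun t _ ↦ by ring
    simp only [h3]
    rw [Finset.sum_comm]
    refine Finset.sum_le_sum fun s hs ↦ ?_
    rw [Finset.sum_comm, Finset.sum_eq_single s]
    · rw [← Finset.mul_sum]
      have := hx1 s hs
      simp only [pow_two] at this ⊢
      nlinarith [mul_self_nonneg (c s)]
    · intro t ht hts
      rw [← Finset.mul_sum, hx s hs t ht hts.symm, mul_zero]
    · intro h; exact absurd hs h
  have h4 : 0 ≤ ∑ m ∈ A, (H m - ∑ s ∈ B, c s * x s m) ^ 2 :=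
    Finset.sum_nonneg fun _ _ ↦ sq_nonneg _
  have h5 : ∑ m ∈ A, (H m - ∑ s ∈ B, c s * x s m) ^ 2 = ∑ m ∈ A, H m ^ 2 -
      2 * ∑ m ∈ A, H m * ∑ s ∈ B, c s * x s m + ∑ m ∈ A, (∑ s ∈ B, c s * x s m) ^ 2 := by
    rw [Finset.mul_sum, ← Finset.sum_sub_distrib, ← Finset.sum_add_distrib]
    exact Finset.sum_congr rfl fun m _ ↦ by ring
  rw [h5, h1] at h4
  linarith

theorem sum_cg_comp_sq_le_one (l₁ l₂ l : ℕ) (T : Finset ℤ) {e : ℤ → ℤ}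
    (he : Function.Injective e) : ∑ m ∈ T, cg l₁ l₂ l (e m) (-(e m)) ^ 2 ≤ 1 := by
  have h := sum_cg_sq_le_one l₁ l₂ l 0
  simp only [zero_sub] at h
  refine le_trans ?_ h
  rw [← Finset.sum_image (f := fun m ↦ cg l₁ l₂ l m (-m) ^ 2) (fun _ _ _ _ h ↦ he h)]
  rw [← Finset.sum_filter_ne_zero]
  refine Finset.sum_le_sum_of_subset_of_nonneg (fun m hm ↦ ?_) (fun _ _ _ ↦ sq_nonneg _)
  rw [Finset.mem_Icc, ← abs_le]
  exact (cg_support (ne_zero_pow two_ne_zero (Finset.mem_filter.mp hm).2)).1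

/-- The symmetries turn the second factor of `recouplingRow` into a coefficient of total spin `l`. -/
theorem mul_recouplingRow_sq (l₁ j l l₂ : ℕ) (m : ℤ) :
    (2 * l + 1) * recouplingRow l₁ j l l₂ m ^ 2 =
      (2 * l₂ + 1) * (cg l₁ j l m (-m) ^ 2 * cg l₂ j l (-m) m ^ 2) := by
  have h := cg_sq_exchange j l l₂ (-m) 0
  rw [add_zero, neg_neg, cg_swap j l₂ l, neg_neg] at h
  rw [recouplingRow, mul_pow]
  linear_combination cg l₁ j l m (-m) ^ 2 * h

theorem sum_recouplingRow_sq_le {l₁ l₂ l j a : ℕ} (ha : a = l₁ ∨ a = l₂) {κ : ℝ}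
    (hκ : ∀ m, cg a j l m (-m) ^ 2 ≤ κ) :
    (2 * l + 1) * ∑ m ∈ Finset.Icc (-(l₁ : ℤ)) l₁, recouplingRow l₁ j l l₂ m ^ 2 ≤
      (2 * l₂ + 1) * κ := by
  have hκ0 : 0 ≤ κ := (sq_nonneg _).trans (hκ 0)
  rw [Finset.mul_sum]
  simp only [mul_recouplingRow_sq]
  rw [← Finset.mul_sum]
  refine mul_le_mul_of_nonneg_left ?_ (by positivity)
  rcases ha with rfl | rfl
  · refine (Finset.sum_le_sum fun m _ ↦
      mul_le_mul_of_nonneg_right (hκ m) (sq_nonneg (cg l₂ j l (-m) m))).trans ?_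
    rw [← Finset.mul_sum]
    have := sum_cg_comp_sq_le_one l₂ j l (Finset.Icc (-(a : ℤ)) a) neg_injective
    simp only [neg_neg] at this
    exact mul_le_of_le_one_right hκ0 this
  · have h1 : ∀ m, cg a j l (-m) m ^ 2 ≤ κ := fun m ↦ by simpa using hκ (-m)
    refine (Finset.sum_le_sum fun m _ ↦
      mul_le_mul_of_nonneg_left (h1 m) (sq_nonneg (cg l₁ j l m (-m)))).trans ?_
    rw [← Finset.sum_mul]
    have := sum_cg_comp_sq_le_one l₁ j l (Finset.Icc (-(l₁ : ℤ)) l₁) Function.injective_id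
    exact mul_le_of_le_one_left hκ0 this

/-- Up to a factor, the sum of products of `6j` coefficients pairs the coefficients of two vectors
of norm at most `1` in an orthonormal system; a pointwise bound on one of the Clebsch-Gordan
coefficients from which these vectors are built bounds it. -/
theorem sum_sixJ_le {l l₁ l₂ j₁ j₂ a b : ℕ} (ha : a = l₁ ∨ a = l₂) (hb : b = j₁ ∨ b = j₂)
    {κ : ℝ} (hκ0 : 0 ≤ κ) (hκ : ∀ m, cg a b l m (-m) ^ 2 ≤ κ ^ 2) :
    ∑ s ∈ Finset.range (2 * l + 1),
      (2 * (s : ℝ) + 1) * (2 * (l : ℝ) + 1) * clebschGordan l 0 s 0 l 0 ^ 2 *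
        sixJ l₁ j₁ l l s l₂ * sixJ l₁ j₂ l l s l₂ ≤ κ := by
  set A := Finset.Icc (-(l₁ : ℤ)) l₁ with hA
  let c : ℕ → ℕ → ℝ := fun j s ↦ ∑ m ∈ A, recouplingRow l₁ j l l₂ m * cg l₁ l₂ s m (-m)
  let r : ℝ := (2 * l + 1) / (2 * l₂ + 1)
  have hr : 0 < r := by positivity
  have hterm : ∀ s ∈ Finset.range (2 * l + 1),
      (2 * (s : ℝ) + 1) * (2 * (l : ℝ) + 1) * clebschGordan l 0 s 0 l 0 ^ 2 *
        sixJ l₁ j₁ l l s l₂ * sixJ l₁ j₂ l l s l₂ =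
      (-1) ^ (j₁ + j₂) * (r * (c j₁ s * c j₂ s)) := by
    intro s hs
    have hs' : s ≤ 2 * l := by have := Finset.mem_range.mp hs; omega
    have h1 : clebschGordan l 0 s 0 l 0 = cg l s l 0 0 := by simp [cg]
    have h2 := cg_sq_exchange l s l 0 0
    have h3 : √((2 * (l : ℝ) + 1) * (2 * l₂ + 1)) ^ 2 = (2 * l + 1) * (2 * l₂ + 1) :=
      Real.sq_sqrt (by positivity)
    have h4 : √((2 * (l : ℝ) + 1) * (2 * l₂ + 1)) ≠ 0 := by positivity
    have h5 : (-1 : ℝ) ^ (l₁ + j₁ + l + s) * (-1) ^ (l₁ + j₂ + l + s) = (-1) ^ (j₁ + j₂) := by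
      rw [← pow_add, show l₁ + j₁ + l + s + (l₁ + j₂ + l + s) = 2 * (l₁ + l + s) + (j₁ + j₂) by ring,
        pow_add, pow_mul]
      simp
    simp only [add_zero, neg_zero] at h2
    simp only [c, hA, sum_recouplingRow_mul_cg hs', h1, sixJ_eq_recoupling, r]
    generalize recoupling l₁ j₁ l l l₂ s s = R₁ at *
    generalize recoupling l₁ j₂ l l l₂ s s = R₂ at *
    generalize √((2 * (l : ℝ) + 1) * (2 * l₂ + 1)) = w at *
    calc _ = ((2 * (s : ℝ) + 1) * cg l s l 0 0 ^ 2) * (2 * l + 1) *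
          ((-1 : ℝ) ^ (l₁ + j₁ + l + s) * (-1) ^ (l₁ + j₂ + l + s)) * R₁ * R₂ / w ^ 2 := by
          field_simp
      _ = _ := by
          rw [h2, h5, h3]
          have : (2 * (l : ℝ) + 1) ≠ 0 := by positivity
          field_simp
  rw [Finset.sum_congr rfl hterm, ← Finset.mul_sum, ← Finset.mul_sum]
  have hbessel : ∀ j, ∑ s ∈ Finset.range (2 * l + 1), c j s ^ 2 ≤
      ∑ m ∈ A, recouplingRow l₁ j l l₂ m ^ 2 := by
    intro j
    refine sum_sq_sum_mul_le A _ (fun s m ↦ cg l₁ l₂ s m (-m)) ?_ ?_ _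
    · intro s _ t _ hst; exact sum_cg_mul_cg_eq_zero hst
    · intro s _; simpa using sum_cg_sq_le_one l₁ l₂ s 0
  have hV : ∀ j (κ : ℝ), ((2 * (l : ℝ) + 1) * ∑ m ∈ A, recouplingRow l₁ j l l₂ m ^ 2 ≤
      (2 * l₂ + 1) * κ) → r * ∑ s ∈ Finset.range (2 * l + 1), c j s ^ 2 ≤ κ := by
    intro j κ h
    refine (mul_le_mul_of_nonneg_left (hbessel j) hr.le).trans ?_
    simp only [r]
    rw [div_mul_eq_mul_div, div_le_iff₀ (by positivity)]
    linarith
  have h1 : ∀ j, r * ∑ s ∈ Finset.range (2 * l + 1), c j s ^ 2 ≤ 1 := fun j ↦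
    hV j 1 (sum_recouplingRow_sq_le (Or.inl rfl) fun m ↦ cg_sq_le_one _ _ _ _ _)
  have h2 : r * ∑ s ∈ Finset.range (2 * l + 1), c b s ^ 2 ≤ κ ^ 2 :=
    hV b _ (sum_recouplingRow_sq_le ha hκ)
  have hcs := Finset.sum_mul_sq_le_sq_mul_sq (Finset.range (2 * l + 1)) (c j₁) (c j₂)
  set S₁ := ∑ s ∈ Finset.range (2 * l + 1), c j₁ s ^ 2
  set S₂ := ∑ s ∈ Finset.range (2 * l + 1), c j₂ s ^ 2
  have hS₁ : 0 ≤ S₁ := Finset.sum_nonneg fun _ _ ↦ sq_nonneg _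
  have hS₂ : 0 ≤ S₂ := Finset.sum_nonneg fun _ _ ↦ sq_nonneg _
  have hprod : (r * S₁) * (r * S₂) ≤ κ ^ 2 := by
    rcases hb with rfl | rfl
    · calc _ ≤ κ ^ 2 * 1 := mul_le_mul h2 (h1 _) (by positivity) (sq_nonneg κ)
        _ = _ := mul_one _
    · calc _ ≤ 1 * κ ^ 2 := mul_le_mul (h1 _) h2 (by positivity) zero_le_one
        _ = _ := one_mul _
  refine le_of_abs_le (abs_le_of_sq_le_sq ?_ hκ0)
  rw [mul_pow, ← pow_mul, mul_comm (j₁ + j₂) 2, pow_mul, neg_one_sq, one_pow, one_mul, mul_pow]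
  calc r ^ 2 * (∑ s ∈ Finset.range (2 * l + 1), c j₁ s * c j₂ s) ^ 2
      ≤ r ^ 2 * (S₁ * S₂) := mul_le_mul_of_nonneg_left hcs (sq_nonneg r)
    _ = (r * S₁) * (r * S₂) := by ring
    _ ≤ κ ^ 2 := hprod

/-! ### The three-term recurrence -/

/-- The eigenvalue `a (a + 1)` of the Casimir operator in spin `a`. -/
noncomputable def casimir (a : ℕ) : ℝ := a * (a + 1)

/-- The off-diagonal coefficient of the three-term recurrence, between `m` and `m + 1`. -/
noncomputable def offDiag (a b : ℕ) (m : ℤ) : ℝ := ladderCoeff a m * ladderCoeff b m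

/-- Interpolation to the midpoint of `m` and `m + 1` of the diagonal coefficient
`Z - a (a + 1) - b (b + 1) + 2 m ^ 2` of the three-term recurrence. -/
noncomputable def midDiag (a b : ℕ) (Z : ℝ) (m : ℤ) : ℝ :=
  Z - casimir a - casimir b + 2 * (m * (m + 1))

/-- The square of the height over the side `√Z` of the triangle with sides `√(a (a + 1))`,
`√(b (b + 1))` and `√Z`; solutions of the recurrence oscillate for `m ^ 2` smaller than this. -/
noncomputable def heightSq (a b : ℕ) (Z : ℝ) : ℝ :=
  (4 * casimir a * casimir b - (Z - casimir a - casimir b) ^ 2) / (4 * Z)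

/-- The distance of `m (m + 1)` from the turning point. -/
noncomputable def depth (a b : ℕ) (Z : ℝ) (m : ℤ) : ℝ := heightSq a b Z - m * (m + 1)

/-- The value of `midDiag` at the turning point. -/
noncomputable def turningDiag (a b : ℕ) (Z : ℝ) : ℝ :=
  Z - casimir a - casimir b + 2 * heightSq a b Z

/-- The discrete Sonin function of a solution `f` of the recurrence. -/
noncomputable def energy (a b : ℕ) (Z : ℝ) (f : ℤ → ℝ) (m : ℤ) : ℝ :=
  offDiag a b m ^ 2 * (f m ^ 2 + f (m + 1) ^ 2) -
    offDiag a b m * midDiag a b Z m * (f m * f (m + 1))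

/-- The weighted increment of `f ^ 2`. -/
noncomputable def sqIncrement (a b : ℕ) (f : ℤ → ℝ) (m : ℤ) : ℝ :=
  offDiag a b m ^ 2 * (f (m + 1) ^ 2 - f m ^ 2)

/-- The discrete analogue of the derivative of `f`. -/
noncomputable def momentum (a b : ℕ) (Z : ℝ) (f : ℤ → ℝ) (m : ℤ) : ℝ :=
  offDiag a b m * f (m + 1) - midDiag a b Z m / 2 * f m

/-- The properties of `f m = C_{a m b -m}^{l 0}` used to bound it, for `Z = l (l + 1)`, `1 ≤ a ≤ b`
and `1 ≤ l`: it is a vector of norm at most `1` supported in `[-a, a]` and satisfies a three-term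
recurrence. -/
structure IsThreeTermSolution (a b : ℕ) (Z : ℝ) (f : ℤ → ℝ) : Prop where
  one_le : 1 ≤ a
  le : a ≤ b
  two_le : 2 ≤ Z
  lower : ((b : ℝ) - a) * (b - a + 1) ≤ Z
  upper : Z ≤ ((a : ℝ) + b) * (a + b + 1)
  support : ∀ m : ℤ, ¬|m| ≤ a → f m = 0
  recurrence : ∀ m : ℤ, (Z - casimir a - casimir b + 2 * m ^ 2) * f m =
    offDiag a b m * f (m + 1) + offDiag a b (m - 1) * f (m - 1)
  norm : ∑ m ∈ Finset.Icc (-(a : ℤ)) a, f m ^ 2 ≤ 1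

theorem offDiag_nonneg (a b : ℕ) (m : ℤ) : 0 ≤ offDiag a b m :=
  mul_nonneg (Real.sqrt_nonneg _) (Real.sqrt_nonneg _)

theorem offDiag_self (a b : ℕ) : offDiag a b a = 0 := by
  rw [offDiag, ladderCoeff_self, zero_mul]

theorem offDiag_neg_sub_one (a b : ℕ) : offDiag a b (-a - 1) = 0 := by
  rw [offDiag, ladderCoeff_neg_sub_one, zero_mul]

theorem offDiag_sq {a b : ℕ} (hab : a ≤ b) {m : ℤ} (h1 : -a - 1 ≤ m) (h2 : m ≤ a) :
    offDiag a b m ^ 2 = (casimir a - m * (m + 1)) * (casimir b - m * (m + 1)) := by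
  rw [offDiag, mul_pow, ladderCoeff_sq h1 h2, ladderCoeff_sq (by omega) (by omega)]
  rfl

theorem offDiag_pos {a b : ℕ} (hab : a ≤ b) {m : ℤ} (h1 : -a ≤ m) (h2 : m < a) :
    0 < offDiag a b m :=
  mul_pos (ladderCoeff_pos h1 h2) (ladderCoeff_pos (by omega) (by omega))

theorem sum_Icc_sub (F : ℤ → ℝ) (n : ℕ) :
    ∑ m ∈ Finset.Icc (-(n : ℤ)) n, (F m - F (m - 1)) = F n - F (-n - 1) := by
  have h := Finset.sum_range_sub (fun i : ℕ ↦ F ((i : ℤ) - n - 1)) (2 * n + 1)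
  have e : ((2 * n + 1 : ℕ) : ℤ) - n - 1 = n := by push_cast; ring
  rw [e] at h
  simp only [Nat.cast_zero, zero_sub] at h
  rw [← h]
  symm
  refine Finset.sum_nbij' (fun i : ℕ ↦ (i : ℤ) - n) (fun m ↦ (m + n).toNat) ?_ ?_ ?_ ?_ ?_
  · intro i hi; rw [Finset.mem_range] at hi; rw [Finset.mem_Icc]; omega
  · intro m hm; rw [Finset.mem_Icc] at hm; rw [Finset.mem_range]; omega
  · intro i _; simp
  · intro m hm; rw [Finset.mem_Icc] at hm; omega
  · intro i _; push_cast; rw [show (i : ℤ) + 1 - n - 1 = i - n by ring]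

theorem midDiag_eq (a b : ℕ) (Z : ℝ) (m : ℤ) :
    midDiag a b Z m = turningDiag a b Z - 2 * depth a b Z m := by
  rw [midDiag, turningDiag, depth]; ring

theorem energy_self (a b : ℕ) (Z : ℝ) (f : ℤ → ℝ) : energy a b Z f a = 0 := by
  rw [energy, offDiag_self]; ring

theorem depth_sub_one (a b : ℕ) (Z : ℝ) (m : ℤ) :
    depth a b Z (m - 1) = depth a b Z m + 2 * m := by
  rw [depth, depth]; push_cast; ring

theorem depth_anti (a b : ℕ) (Z : ℝ) {m n : ℕ} (h : m ≤ n) :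
    depth a b Z n ≤ depth a b Z m := by
  have : (m : ℝ) ≤ n := by exact_mod_cast h
  have h0 : (0 : ℝ) ≤ m := Nat.cast_nonneg m
  rw [depth, depth]
  push_cast
  nlinarith

/-- The points `m` of nonnegative depth are at most the height. -/
theorem natCast_le_sqrt_heightSq {a b : ℕ} {Z : ℝ} {m : ℕ} (hm : 0 ≤ depth a b Z m) :
    (m : ℝ) ≤ √(heightSq a b Z) := by
  refine Real.le_sqrt_of_sq_le ?_
  rw [depth] at hm
  push_cast at hm
  have h0 : (0 : ℝ) ≤ m := Nat.cast_nonneg m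
  nlinarith

theorem depth_le_two_mul_sq {a b : ℕ} {Z t : ℝ} (hh : 1 ≤ √(heightSq a b Z))
    (ht2 : 10 ^ 4 * √(heightSq a b Z) ≤ t ^ 2) {n : ℕ} (h1 : t ^ 2 ≤ depth a b Z n)
    (h2 : depth a b Z (n + 1 : ℕ) < t ^ 2) : depth a b Z n ≤ 2 * t ^ 2 := by
  have h3 := natCast_le_sqrt_heightSq ((sq_nonneg t).trans h1)
  have h4 := depth_sub_one a b Z (n + 1 : ℕ)
  push_cast at h4 h2
  rw [add_sub_cancel_right] at h4
  linarith

namespace IsThreeTermSolution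

variable {a b : ℕ} {Z : ℝ} {f : ℤ → ℝ}

theorem Z_pos (hf : IsThreeTermSolution a b Z f) : 0 < Z := by linarith [hf.two_le]

theorem four_mul_heightSq (hf : IsThreeTermSolution a b Z f) :
    4 * Z * heightSq a b Z =
      4 * casimir a * casimir b - (Z - casimir a - casimir b) ^ 2 := by
  have := hf.Z_pos
  rw [heightSq]; field_simp

theorem four_mul_offDiag_sq (hf : IsThreeTermSolution a b Z f) {m : ℤ} (h1 : -a - 1 ≤ m)
    (h2 : m ≤ a) :
    4 * offDiag a b m ^ 2 = midDiag a b Z m ^ 2 + 4 * Z * depth a b Z m := by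
  have := hf.four_mul_heightSq
  rw [offDiag_sq hf.le h1 h2, midDiag, depth]
  linear_combination -this

/-- Completing the square; in the oscillatory region both terms are nonnegative. -/
theorem energy_eq_left (hf : IsThreeTermSolution a b Z f) {m : ℤ} (h1 : -a - 1 ≤ m)
    (h2 : m ≤ a) :
    energy a b Z f m = momentum a b Z f m ^ 2 + Z * depth a b Z m * f m ^ 2 := by
  have := hf.four_mul_offDiag_sq h1 h2
  rw [energy, momentum]
  linear_combination f m ^ 2 / 4 * this

/-- The Sonin function changes by a multiple of `f ^ 2`, with no other terms: this is special to
the coefficients of the present recurrence. -/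
theorem energy_sub_energy (hf : IsThreeTermSolution a b Z f) {m : ℤ} (h : |m| ≤ a) :
    energy a b Z f m - energy a b Z f (m - 1) = -(2 * m * Z * f m ^ 2) := by
  rw [abs_le] at h
  have e1 := offDiag_sq hf.le (m := m) (by omega) (by omega)
  have e2 := offDiag_sq hf.le (m := m - 1) (by omega) (by omega)
  have r := hf.recurrence m
  rw [energy, energy, midDiag, midDiag, sub_add_cancel]
  push_cast at *
  linear_combination f m ^ 2 * e1 - f m ^ 2 * e2 -
    (offDiag a b m * f (m + 1) - offDiag a b (m - 1) * f (m - 1) - 2 * m * f m) * r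

/-- The first variation of `sqIncrement`. It shows that `4 Z * depth * f ^ 2` equals twice the
energy up to a difference and small terms: on average, `f ^ 2` takes half of its maximal size. -/
theorem sqIncrement_sub_sqIncrement (hf : IsThreeTermSolution a b Z f) {m : ℤ} (h : |m| ≤ a) :
    sqIncrement a b f m - sqIncrement a b f (m - 1) =
      energy a b Z f m + energy a b Z f (m - 1) -
        4 * Z * (heightSq a b Z - m ^ 2) * f m ^ 2 + 4 * m * f m * momentum a b Z f m := by
  rw [abs_le] at h
  have e1 := offDiag_sq hf.le (m := m) (by omega) (by omega)
  have e2 := offDiag_sq hf.le (m := m - 1) (by omega) (by omega)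
  have e3 := hf.four_mul_heightSq
  have r := hf.recurrence m
  rw [energy, energy, sqIncrement, sqIncrement, momentum, midDiag, midDiag, sub_add_cancel]
  push_cast at *
  linear_combination f m ^ 2 * e3 - 2 * f m ^ 2 * e1 - 2 * f m ^ 2 * e2 -
    (Z - casimir a - casimir b + 2 * m ^ 2 - 2 * m) * f m * r

/-! ### A priori bounds -/

/-- The triangle inequalities bound the height from below. -/
theorem half_natCast_le_heightSq (hf : IsThreeTermSolution a b Z f) : (a : ℝ) / 2 ≤ heightSq a b Z := by
  have h := hf.four_mul_heightSq
  have hZ := hf.Z_pos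
  have hab : (a : ℝ) ≤ b := by exact_mod_cast hf.le
  have h1 := mul_nonneg (sub_nonneg.mpr hf.lower) (sub_nonneg.mpr hf.upper)
  have h2 : 0 ≤ 2 * (a : ℝ) * (b - a) * (a + b + 1) := by
    have := sub_nonneg.mpr hab
    positivity
  have h3 : 4 * Z * heightSq a b Z - 2 * a * Z =
      (Z - (b - a) * (b - a + 1)) * ((a + b) * (a + b + 1) - Z) +
        2 * a * (b - a) * (a + b + 1) := by
    rw [h, casimir, casimir]; ring
  have h4 : 0 ≤ 4 * Z * (heightSq a b Z - a / 2) := by linarith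
  nlinarith

theorem half_le_heightSq (hf : IsThreeTermSolution a b Z f) : 1 / 2 ≤ heightSq a b Z := by
  have h := hf.half_natCast_le_heightSq
  have : (1 : ℝ) ≤ a := by exact_mod_cast hf.one_le
  linarith

/-- The difference of `casimir a` and the squared height is the square of the length of the
projection of a side to the side `√Z`. -/
theorem casimir_sub_heightSq (hf : IsThreeTermSolution a b Z f) :
    casimir a - heightSq a b Z = (Z - (casimir b - casimir a)) ^ 2 / (4 * Z) := by
  have := hf.Z_pos
  rw [heightSq]; field_simp; ring

theorem turningDiag_eq (hf : IsThreeTermSolution a b Z f) :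
    turningDiag a b Z = (Z ^ 2 - (casimir b - casimir a) ^ 2) / (2 * Z) := by
  have := hf.Z_pos
  rw [turningDiag, heightSq]; field_simp; ring

theorem heightSq_le_casimir (hf : IsThreeTermSolution a b Z f) :
    heightSq a b Z ≤ casimir a := by
  have h := hf.casimir_sub_heightSq
  have h2 := hf.Z_pos
  have : 0 ≤ (Z - (casimir b - casimir a)) ^ 2 / (4 * Z) := by positivity
  linarith

theorem casimir_le_casimir (hf : IsThreeTermSolution a b Z f) : casimir a ≤ casimir b := by
  have hab : (a : ℝ) ≤ b := by exact_mod_cast hf.le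
  unfold casimir; gcongr

theorem turningDiag_le (hf : IsThreeTermSolution a b Z f) : turningDiag a b Z ≤ Z := by
  have h2 := hf.Z_pos
  rw [hf.turningDiag_eq, div_le_iff₀ (by positivity)]
  nlinarith [sq_nonneg (casimir b - casimir a)]

theorem casimir_le_heightSq_add (hf : IsThreeTermSolution a b Z f) :
    casimir a * Z ≤ heightSq a b Z * Z + turningDiag a b Z ^ 2 := by
  have h1 := hf.casimir_sub_heightSq
  have h2 := hf.Z_pos
  have h3 := sub_nonneg.mpr hf.casimir_le_casimir
  rw [hf.turningDiag_eq]
  set δ := casimir b - casimir a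
  have h4 : (casimir a - heightSq a b Z) * Z = (Z - δ) ^ 2 / 4 := by rw [h1]; field_simp
  have h5 : ((Z ^ 2 - δ ^ 2) / (2 * Z)) ^ 2 = (Z - δ) ^ 2 / 4 * ((Z + δ) / Z) ^ 2 := by
    field_simp; ring
  have h6 : 1 ≤ (Z + δ) / Z := by rw [le_div_iff₀ h2]; linarith
  have h7 : 1 ≤ ((Z + δ) / Z) ^ 2 := one_le_pow₀ h6
  nlinarith [mul_nonneg (sq_nonneg (Z - δ)) (sub_nonneg.mpr h7)]

theorem energy_anti (hf : IsThreeTermSolution a b Z f) {m n : ℕ} (hmn : m ≤ n) (hn : n ≤ a) :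
    energy a b Z f n ≤ energy a b Z f m := by
  induction n, hmn using Nat.le_induction with
  | base => exact le_rfl
  | succ k hk ih =>
    refine le_trans ?_ (ih (by omega))
    have h := hf.energy_sub_energy (m := (k + 1 : ℕ)) (by rw [abs_le]; omega)
    have e : ((k + 1 : ℕ) : ℤ) - 1 = k := by push_cast; ring
    rw [e] at h
    have h2 := hf.Z_pos
    have : 0 ≤ 2 * (((k + 1 : ℕ) : ℤ) : ℝ) * Z * f ((k + 1 : ℕ) : ℤ) ^ 2 := by
      push_cast; positivity
    linarith

theorem energy_nonneg (hf : IsThreeTermSolution a b Z f) {m : ℕ} (hm : m ≤ a) :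
    0 ≤ energy a b Z f m := by
  rw [← energy_self a b Z f]; exact hf.energy_anti hm le_rfl

/-- The energy at `n` controls `f` at all later points, since it is a sum over them. -/
theorem sq_le_energy_of_lt (hf : IsThreeTermSolution a b Z f) {n k : ℕ} (hnk : n < k)
    (hk : k ≤ a) : 2 * Z * k * f k ^ 2 ≤ energy a b Z f n := by
  obtain ⟨j, rfl⟩ : ∃ j, k = j + 1 := ⟨k - 1, by omega⟩
  have h := hf.energy_sub_energy (m := (j + 1 : ℕ)) (by rw [abs_le]; omega)
  have e : ((j + 1 : ℕ) : ℤ) - 1 = j := by push_cast; ring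
  rw [e] at h
  have h1 := hf.energy_anti (m := n) (n := j) (by omega) (by omega)
  have h2 := hf.energy_nonneg hk
  push_cast at *
  linarith

theorem depth_mul_sq_le (hf : IsThreeTermSolution a b Z f) {m : ℕ} (hm : m ≤ a) :
    Z * depth a b Z m * f m ^ 2 ≤ energy a b Z f m := by
  rw [hf.energy_eq_left (by omega) (by omega)]
  linarith [sq_nonneg (momentum a b Z f m)]

/-- The second moment of `f ^ 2` is at most of the size of the squared height: a combination `Φ` of
`sqIncrement`, `energy` and `offDiag a b m * f m * f (m + 1)` that vanishes at both ends has as its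
increments linear combinations of `m ^ 2 * f m ^ 2` and `f m ^ 2`. -/
theorem sum_sq_mul_sq_le (hf : IsThreeTermSolution a b Z f) :
    ∑ m ∈ Finset.Icc (-(a : ℤ)) a, (m : ℝ) ^ 2 * f m ^ 2 ≤ 2 * heightSq a b Z := by
  let Φ : ℤ → ℝ := fun m ↦ sqIncrement a b f m -
    (2 * m + 1) * (energy a b Z f m + offDiag a b m * (f m * f (m + 1)))
  have h1 : ∀ m ∈ Finset.Icc (-(a : ℤ)) a, Φ m - Φ (m - 1) =
      (8 * Z - 6) * ((m : ℝ) ^ 2 * f m ^ 2) -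
        (4 * Z * heightSq a b Z + Z - casimir a - casimir b) * f m ^ 2 := by
    intro m hm
    rw [Finset.mem_Icc, ← abs_le] at hm
    have e1 := hf.energy_sub_energy hm
    have e2 := hf.sqIncrement_sub_sqIncrement hm
    have r := hf.recurrence m
    simp only [Φ]
    rw [momentum, midDiag] at e2
    rw [sub_add_cancel]
    push_cast
    linear_combination e2 - 2 * m * e1 + (1 - 2 * m) * f m * r
  have h2 := Finset.sum_congr rfl h1
  rw [sum_Icc_sub, Finset.sum_sub_distrib, ← Finset.mul_sum, ← Finset.mul_sum] at h2
  have h3 : Φ a = 0 := by simp only [Φ, energy, sqIncrement, offDiag_self]; ring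
  have h4 : Φ (-a - 1) = 0 := by simp only [Φ, energy, sqIncrement, offDiag_neg_sub_one]; ring
  rw [h3, h4] at h2
  have hN := hf.norm
  have hN0 : 0 ≤ ∑ m ∈ Finset.Icc (-(a : ℤ)) a, f m ^ 2 :=
    Finset.sum_nonneg fun _ _ ↦ sq_nonneg _
  have hE0 : 0 ≤ ∑ m ∈ Finset.Icc (-(a : ℤ)) a, (m : ℝ) ^ 2 * f m ^ 2 :=
    Finset.sum_nonneg fun _ _ ↦ by positivity
  have hZ := hf.two_le
  have hH := hf.half_le_heightSq
  have hX : 0 ≤ casimir a := by unfold casimir; positivity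
  have hY : 0 ≤ casimir b := by unfold casimir; positivity
  set N := ∑ m ∈ Finset.Icc (-(a : ℤ)) a, f m ^ 2
  set E := ∑ m ∈ Finset.Icc (-(a : ℤ)) a, (m : ℝ) ^ 2 * f m ^ 2
  have hZH : 0 ≤ Z * heightSq a b Z := by positivity
  have h5 : 5 * Z * E ≤ (8 * Z - 6) * E := mul_le_mul_of_nonneg_right (by linarith) hE0
  have h6 : (4 * Z * heightSq a b Z + Z - casimir a - casimir b) * N ≤
      4 * Z * heightSq a b Z + Z := by
    calc _ ≤ (4 * Z * heightSq a b Z + Z) * N := mul_le_mul_of_nonneg_right (by linarith) hN0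
      _ ≤ (4 * Z * heightSq a b Z + Z) * 1 := mul_le_mul_of_nonneg_left hN (by nlinarith)
      _ = _ := mul_one _
  have h7 : Z * (5 * E) ≤ Z * (4 * heightSq a b Z + 1) := by linarith
  have h8 := le_of_mul_le_mul_left h7 (by linarith)
  linarith

theorem energy_zero_eq (hf : IsThreeTermSolution a b Z f) {n : ℕ} (hn : n ≤ a) :
    energy a b Z f 0 = energy a b Z f n +
      2 * Z * ∑ k ∈ Finset.range n, ((k : ℝ) + 1) * f ((k : ℤ) + 1) ^ 2 := by
  induction n with
  | zero => simp
  | succ n ih =>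
    have h := hf.energy_sub_energy (m := (n + 1 : ℕ)) (by rw [abs_le]; omega)
    rw [ih (by omega), Finset.sum_range_succ]
    push_cast at *
    rw [add_sub_cancel_right] at h
    linear_combination -h

/-- The energy at `0` is `2 Z` times the first moment of `f ^ 2` on the positive half-axis, which is
bounded through the second moment by `m ≤ m ^ 2 / (2 h) + h / 2`. -/
theorem energy_zero_le (hf : IsThreeTermSolution a b Z f) :
    energy a b Z f 0 ≤ 3 * Z * √(heightSq a b Z) := by
  have hH := hf.half_le_heightSq
  set h := √(heightSq a b Z) with hh
  have hpos : 0 < h := Real.sqrt_pos.mpr (by linarith)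
  have hsq : h ^ 2 = heightSq a b Z := Real.sq_sqrt (by linarith)
  have h1 : ∑ k ∈ Finset.range a, ((k : ℝ) + 1) * f ((k : ℤ) + 1) ^ 2 ≤
      ∑ m ∈ Finset.Icc (-(a : ℤ)) a,
        (1 / (2 * h) * ((m : ℝ) ^ 2 * f m ^ 2) + h / 2 * f m ^ 2) := by
    have hinj : Set.InjOn (fun k : ℕ ↦ (k : ℤ) + 1) (Finset.range a) :=
      fun i _ j _ hij ↦ by simpa using hij
    calc _ = ∑ m ∈ (Finset.range a).image (fun k : ℕ ↦ (k : ℤ) + 1), (m : ℝ) * f m ^ 2 := by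
          rw [Finset.sum_image hinj]; push_cast; rfl
      _ ≤ ∑ m ∈ (Finset.range a).image (fun k : ℕ ↦ (k : ℤ) + 1),
          (1 / (2 * h) * ((m : ℝ) ^ 2 * f m ^ 2) + h / 2 * f m ^ 2) := by
          refine Finset.sum_le_sum fun m _ ↦ ?_
          have e : 1 / (2 * h) * ((m : ℝ) ^ 2 * f m ^ 2) + h / 2 * f m ^ 2 - m * f m ^ 2 =
              (m - h) ^ 2 * f m ^ 2 / (2 * h) := by field_simp; ring
          have : 0 ≤ ((m : ℝ) - h) ^ 2 * f m ^ 2 / (2 * h) := by positivity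
          linarith
      _ ≤ _ := by
          refine Finset.sum_le_sum_of_subset_of_nonneg ?_ fun m _ _ ↦ by positivity
          intro m hm
          simp only [Finset.mem_image, Finset.mem_range] at hm
          obtain ⟨k, hk, rfl⟩ := hm
          rw [Finset.mem_Icc]; omega
  rw [Finset.sum_add_distrib, ← Finset.mul_sum, ← Finset.mul_sum] at h1
  have h2 := mul_le_mul_of_nonneg_left hf.sum_sq_mul_sq_le (by positivity : 0 ≤ 1 / (2 * h))
  have h3 := mul_le_mul_of_nonneg_left hf.norm (by positivity : 0 ≤ h / 2)
  have h4 : 1 / (2 * h) * (2 * heightSq a b Z) = h := by rw [← hsq]; field_simp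
  rw [hf.energy_zero_eq le_rfl, energy_self]
  have hZ := hf.Z_pos
  have h5 : ∑ k ∈ Finset.range a, ((k : ℝ) + 1) * f ((k : ℤ) + 1) ^ 2 ≤ 3 / 2 * h := by linarith
  have := mul_le_mul_of_nonneg_left h5 (by positivity : 0 ≤ 2 * Z)
  linarith

end IsThreeTermSolution

/-! ### Decay of the energy towards the turning point -/

theorem rpow_neg_sub_rpow_neg_le {x y p : ℝ} (hx : 0 < x) (hxy : x ≤ y) (hp : 0 ≤ p) :
    x ^ (-p) - y ^ (-p) ≤ p * (y - x) * x ^ (-p - 1) := by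
  have hy : 0 < y := hx.trans_le hxy
  have h1 : 1 - p * (y / x - 1) ≤ (y / x) ^ (-p) := by
    rw [Real.rpow_def_of_pos (by positivity)]
    have h2 := Real.add_one_le_exp (Real.log (y / x) * -p)
    have h3 := Real.log_le_sub_one_of_pos (x := y / x) (by positivity)
    nlinarith
  rw [Real.div_rpow hy.le hx.le] at h1
  have hxp : 0 < x ^ (-p) := by positivity
  rw [le_div_iff₀ hxp] at h1
  have h4 : x ^ (-p) = x ^ (-p - 1) * x := by
    rw [← Real.rpow_add_one hx.ne']; congr 1; ring
  have h5 : (1 - p * (y / x - 1)) * x ^ (-p) = x ^ (-p) - p * (y - x) * x ^ (-p - 1) := by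
    rw [h4]; field_simp
  linarith

namespace IsThreeTermSolution

variable {a b : ℕ} {Z : ℝ} {f : ℤ → ℝ}

theorem abs_sqIncrement_le (hf : IsThreeTermSolution a b Z f) {m : ℕ} (hm : m ≤ a)
    (hx : 0 ≤ depth a b Z m) :
    √Z * √(depth a b Z m) * |sqIncrement a b f m| ≤ offDiag a b m * energy a b Z f m := by
  have hZ := hf.Z_pos
  have h := hf.four_mul_offDiag_sq (m := m) (by omega) (by omega)
  have h0 : 0 ≤ offDiag a b m * energy a b Z f m :=
    mul_nonneg (offDiag_nonneg _ _ _) (hf.energy_nonneg hm)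
  refine le_of_abs_le (abs_le_of_sq_le_sq ?_ h0)
  rw [mul_pow, mul_pow, Real.sq_sqrt hZ.le, Real.sq_sqrt hx, sq_abs]
  have e : (offDiag a b m * energy a b Z f m) ^ 2 - Z * depth a b Z m * sqIncrement a b f m ^ 2 =
      (offDiag a b m ^ 2 * (2 * offDiag a b m * (f m * f (m + 1)) -
        midDiag a b Z m / 2 * (f m ^ 2 + f (m + 1) ^ 2))) ^ 2 := by
    rw [energy, sqIncrement]
    linear_combination (offDiag a b m ^ 4 * (f (m + 1) ^ 2 - f m ^ 2) ^ 2 / 4) * h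
  have := sq_nonneg (offDiag a b m ^ 2 * (2 * offDiag a b m * (f m * f (m + 1)) -
        midDiag a b Z m / 2 * (f m ^ 2 + f (m + 1) ^ 2)))
  linarith

theorem abs_mul_momentum_le (hf : IsThreeTermSolution a b Z f) {m : ℕ} (hm : m ≤ a)
    (hx : 0 ≤ depth a b Z m) :
    √Z * √(depth a b Z m) * (2 * |f m * momentum a b Z f m|) ≤ energy a b Z f m := by
  have hZ := hf.Z_pos
  rw [hf.energy_eq_left (by omega) (by omega), abs_mul]
  have h1 : (√Z * √(depth a b Z m)) ^ 2 = Z * depth a b Z m := by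
    rw [mul_pow, Real.sq_sqrt hZ.le, Real.sq_sqrt hx]
  have h2 := sq_nonneg (|momentum a b Z f m| - √Z * √(depth a b Z m) * |f m|)
  have h3 := sq_abs (momentum a b Z f m)
  have h4 := sq_abs (f m)
  rw [← h1, ← h3, ← h4]
  linarith

/-- The conditions under which `m` counts as far enough below the turning point: `f` varies there
on a scale shorter than the distance to the turning point. -/
structure IsOscillatory (a b : ℕ) (Z : ℝ) (m : ℕ) : Prop where
  depth_pos : 0 < depth a b Z m
  le_depth : 100 * (m : ℝ) ≤ depth a b Z m
  offDiag_le : 50 * (m * offDiag a b m) ≤ √Z * √(depth a b Z m) * depth a b Z m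
  le_sqrt : 50 * (m : ℝ) ≤ √Z * √(depth a b Z m)
  depth_le : depth a b Z m ≤ 4 * m ^ 2

theorem mul_abs_sqIncrement_le (hf : IsThreeTermSolution a b Z f) {m : ℕ} (hm : m ≤ a)
    (h : IsOscillatory a b Z m) :
    50 * (m * |sqIncrement a b f m|) ≤ depth a b Z m * energy a b Z f m := by
  have h1 := hf.abs_sqIncrement_le hm h.depth_pos.le
  have hρ : 0 < √Z * √(depth a b Z m) :=
    mul_pos (Real.sqrt_pos.mpr hf.Z_pos) (Real.sqrt_pos.mpr h.depth_pos)
  have h2 := mul_le_mul_of_nonneg_right h.offDiag_le (hf.energy_nonneg hm)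
  have h3 := mul_le_mul_of_nonneg_left h1 (by positivity : (0 : ℝ) ≤ 50 * m)
  refine le_of_mul_le_mul_left ?_ hρ
  linarith

/-- The energy, divided by the power `2 / 5` of the depth, with a correction that makes it decrease.
The energy decreases at the rate `2 m Z f ^ 2`, which on average is `m / depth` times the energy,
but not pointwise, since `f` may be small where it oscillates. The term with `sqIncrement` replaces
`f ^ 2` by its average. The average rate is that of the power `1 / 2` of the depth; the smaller
exponent `2 / 5` leaves room for the error terms. -/
noncomputable def modifiedEnergy (a b : ℕ) (Z : ℝ) (f : ℤ → ℝ) (m : ℕ) : ℝ :=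
  depth a b Z m ^ (-(2 / 5) : ℝ) * energy a b Z f m -
    ((m : ℝ) + 1) / 2 * depth a b Z m ^ (-(7 / 5) : ℝ) * sqIncrement a b f m

theorem abs_modifiedEnergy_sub_le (hf : IsThreeTermSolution a b Z f) {m : ℕ} (hm : m ≤ a)
    (h1 : 1 ≤ m) (h : IsOscillatory a b Z m) :
    |modifiedEnergy a b Z f m - depth a b Z m ^ (-(2 / 5) : ℝ) * energy a b Z f m| ≤
      depth a b Z m ^ (-(2 / 5) : ℝ) * energy a b Z f m / 50 := by
  have h2 := hf.mul_abs_sqIncrement_le hm h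
  have hx := h.depth_pos
  have hm1 : (1 : ℝ) ≤ m := by exact_mod_cast h1
  have hV : 0 < depth a b Z m ^ (-(7 / 5) : ℝ) := by positivity
  have e : depth a b Z m ^ (-(2 / 5) : ℝ) = depth a b Z m ^ (-(7 / 5) : ℝ) * depth a b Z m := by
    rw [← Real.rpow_add_one hx.ne']; norm_num
  have e2 : modifiedEnergy a b Z f m - depth a b Z m ^ (-(2 / 5) : ℝ) * energy a b Z f m =
      -(((m : ℝ) + 1) / 2 * depth a b Z m ^ (-(7 / 5) : ℝ) * sqIncrement a b f m) := by
    rw [modifiedEnergy]; ring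
  rw [e2, abs_neg, abs_mul, abs_of_nonneg (by positivity), e]
  have h3 := abs_nonneg (sqIncrement a b f m)
  have h4 := mul_le_mul_of_nonneg_left h2 hV.le
  have h5 : ((m : ℝ) + 1) / 2 * |sqIncrement a b f m| ≤ m * |sqIncrement a b f m| :=
    mul_le_mul_of_nonneg_right (by linarith) h3
  have h6 := mul_le_mul_of_nonneg_left h5 hV.le
  linarith

/-- By `sqIncrement_sub_sqIncrement`, the main part of the decrement is
`(1 - 4 / 5) * m * depth ^ (-7 / 5) * energy`; it dominates the errors. -/
theorem modifiedEnergy_succ_le (hf : IsThreeTermSolution a b Z f) {m : ℕ} (hm : m + 1 ≤ a)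
    (h : IsOscillatory a b Z (m + 1)) :
    modifiedEnergy a b Z f (m + 1) ≤ modifiedEnergy a b Z f m := by
  have hG := hf.energy_nonneg hm
  have hL := hf.mul_abs_sqIncrement_le hm h
  have hω := hf.abs_mul_momentum_le hm h.depth_pos.le
  have E1 := hf.energy_sub_energy (m := (m + 1 : ℕ)) (by rw [abs_le]; omega)
  have E2 := hf.sqIncrement_sub_sqIncrement (m := (m + 1 : ℕ)) (by rw [abs_le]; omega)
  have hxx := depth_sub_one a b Z (m + 1 : ℕ)
  have hσ : heightSq a b Z - (((m + 1 : ℕ) : ℤ) : ℝ) ^ 2 =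
      depth a b Z (m + 1 : ℕ) + ((m + 1 : ℕ) : ℝ) := by
    rw [depth]; push_cast; ring
  have e : ((m + 1 : ℕ) : ℤ) - 1 = m := by push_cast; ring
  rw [e] at E1 E2 hxx
  rw [hσ] at E2
  have hZ := hf.Z_pos
  have hx := h.depth_pos
  have hc1 := h.le_depth
  have hc3 := h.le_sqrt
  have hc4 := h.depth_le
  rw [modifiedEnergy, modifiedEnergy]
  rw [show ((m : ℝ) + 1) = ((m + 1 : ℕ) : ℝ) by push_cast; ring]
  rw [Int.cast_natCast] at E1 E2 hxx
  have hM : (1 : ℝ) ≤ ((m + 1 : ℕ) : ℝ) := by push_cast; linarith [Nat.cast_nonneg (α := ℝ) m]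
  generalize ((m + 1 : ℕ) : ℝ) = M at *
  generalize depth a b Z m = y at *
  generalize energy a b Z f m = G' at *
  generalize sqIncrement a b f m = L' at *
  generalize depth a b Z (m + 1 : ℕ) = x at *
  generalize energy a b Z f (m + 1 : ℕ) = G at *
  generalize sqIncrement a b f (m + 1 : ℕ) = L at *
  generalize momentum a b Z f (m + 1 : ℕ) = w at *
  generalize f (m + 1 : ℕ) = q at *
  have hω' : 100 * (M * |q * w|) ≤ G := by
    have := mul_le_mul_of_nonneg_right hc3 (abs_nonneg (q * w))
    linarith
  have hy : 0 < y := by linarith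
  have hxy : x ≤ y := by linarith
  have p1 := rpow_neg_sub_rpow_neg_le hx hxy (p := 2 / 5) (by norm_num)
  have p2 := rpow_neg_sub_rpow_neg_le hx hxy (p := 7 / 5) (by norm_num)
  have p3 : y ^ (-(7 / 5) : ℝ) ≤ x ^ (-(7 / 5) : ℝ) :=
    Real.rpow_le_rpow_of_nonpos hx hxy (by norm_num)
  rw [show -(2 / 5 : ℝ) - 1 = -(7 / 5) by norm_num] at p1
  rw [show -(7 / 5 : ℝ) - 1 = -(12 / 5) by norm_num] at p2
  have v1 : x ^ (-(7 / 5) : ℝ) = x ^ (-(12 / 5) : ℝ) * x := by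
    rw [← Real.rpow_add_one hx.ne']; norm_num
  have v2 : y ^ (-(2 / 5) : ℝ) = y ^ (-(7 / 5) : ℝ) * y := by
    rw [← Real.rpow_add_one hy.ne']; norm_num
  have hT : 0 < x ^ (-(12 / 5) : ℝ) := by positivity
  have hV' : 0 < y ^ (-(7 / 5) : ℝ) := by positivity
  generalize x ^ (-(2 / 5) : ℝ) = W at *
  generalize y ^ (-(2 / 5) : ℝ) = W' at *
  generalize x ^ (-(7 / 5) : ℝ) = V at *
  generalize y ^ (-(7 / 5) : ℝ) = V' at *
  generalize x ^ (-(12 / 5) : ℝ) = T at *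
  have hyx : y - x = 2 * M := by linarith
  rw [hyx] at p1 p2
  -- the terms of the difference, each in units of `M * V * G`
  have b1 : (W - W') * G ≤ 4 / 5 * (M * V * G) := by
    have := mul_le_mul_of_nonneg_right p1 hG
    linarith
  have b2 : 0 ≤ M ^ 2 * Z * q ^ 2 * V' := by positivity
  have b3 : 0 ≤ M * V' * (G' - G) := by
    have h3 : 0 ≤ G' - G := by
      have : 0 ≤ 2 * M * Z * q ^ 2 := by positivity
      linarith
    positivity
  have b4 : -(2 * M ^ 2 * V' * (q * w)) ≤ M * V' * G / 50 := by
    have h4 := neg_abs_le (q * w)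
    have h5 := mul_le_mul_of_nonneg_left hω' (by positivity : 0 ≤ M * V')
    have h6 := mul_le_mul_of_nonneg_left h4 (by positivity : 0 ≤ 2 * M ^ 2 * V')
    linarith
  have b5 : -(((M + 1) / 2 * V - M / 2 * V') * L) ≤ 17 / 250 * (M * V * G) := by
    have h4 := neg_abs_le L
    have hc : (M + 1) / 2 * V - M / 2 * V' ≤ 17 / 5 * M ^ 2 * T := by
      have h7 := mul_le_mul_of_nonneg_left hc4 hT.le
      have h8 := mul_le_mul_of_nonneg_left p2 (by positivity : 0 ≤ M / 2)
      linarith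
    have hc0 : 0 ≤ (M + 1) / 2 * V - M / 2 * V' := by
      have : 0 < V := by rw [v1]; positivity
      have h8 := mul_le_mul_of_nonneg_left p3 (by positivity : 0 ≤ M / 2)
      linarith
    have h9 := mul_le_mul_of_nonneg_left h4 hc0
    have h10 := mul_le_mul_of_nonneg_right hc (abs_nonneg L)
    have h11 := mul_le_mul_of_nonneg_left hL (by positivity : 0 ≤ M * T)
    have h12 : M * T * (x * G) = M * V * G := by rw [v1]; ring
    rw [h12] at h11
    linarith
  have b6 : 243 / 250 * (M * V * G) ≤ M * V' * G := by
    have h7 : 243 / 250 * V ≤ V' := by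
      have h8 := mul_le_mul_of_nonneg_left hc1 hT.le
      linarith
    have := mul_le_mul_of_nonneg_right h7 (by positivity : 0 ≤ M * G)
    linarith
  have b7 : 0 ≤ M * V * G := by
    have : 0 < V := by rw [v1]; positivity
    positivity
  have key : W * G - (M + 1) / 2 * V * L - (W' * G' - M / 2 * V' * L') =
      (W - W') * G - 2 * (M ^ 2 * Z * q ^ 2 * V') - M / 2 * V' * (G' - G) - M * V' * G -
        2 * M ^ 2 * V' * (q * w) - ((M + 1) / 2 * V - M / 2 * V') * L := by
    rw [v2, hxx]
    linear_combination (V' * x + 2 * V' * M) * E1 - M / 2 * V' * E2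
  linarith

/-- Between two points below the turning point, the energy decreases at least like the power
`2 / 5` of the depth. -/
theorem energy_pow_mul_le (hf : IsThreeTermSolution a b Z f) {m n : ℕ} (h1 : 1 ≤ m)
    (hmn : m ≤ n) (hn : n ≤ a) (h : ∀ k, m ≤ k → k ≤ n → IsOscillatory a b Z k) :
    energy a b Z f n ^ 5 * depth a b Z m ^ 2 ≤ 2 * energy a b Z f m ^ 5 * depth a b Z n ^ 2 := by
  have hmono : modifiedEnergy a b Z f n ≤ modifiedEnergy a b Z f m := by
    induction n, hmn using Nat.le_induction with
    | base => exact le_rfl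
    | succ k hk ih =>
      exact (hf.modifiedEnergy_succ_le hn (h _ (by omega) le_rfl)).trans
        (ih (by omega) fun j h1 h2 ↦ h j h1 (by omega))
  have am := abs_le.mp (hf.abs_modifiedEnergy_sub_le (hmn.trans hn) h1 (h m le_rfl hmn))
  have an := abs_le.mp (hf.abs_modifiedEnergy_sub_le hn (h1.trans hmn) (h n hmn le_rfl))
  have hx := (h m le_rfl hmn).depth_pos
  have hy := (h n hmn le_rfl).depth_pos
  have hGm := hf.energy_nonneg (hmn.trans hn)
  have hGn := hf.energy_nonneg hn
  have e : ∀ x : ℝ, 0 < x → (x ^ (-(2 / 5) : ℝ)) ^ 5 * x ^ 2 = 1 := by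
    intro x hx
    rw [← Real.rpow_natCast, ← Real.rpow_mul hx.le, ← Real.rpow_natCast, ← Real.rpow_add hx]
    norm_num
  have em := e _ hx
  have en := e _ hy
  have hWm : 0 < depth a b Z m ^ (-(2 / 5) : ℝ) := by positivity
  have hWn : 0 < depth a b Z n ^ (-(2 / 5) : ℝ) := by positivity
  generalize depth a b Z m ^ (-(2 / 5) : ℝ) = W at *
  generalize depth a b Z n ^ (-(2 / 5) : ℝ) = V at *
  generalize depth a b Z m = x at *
  generalize depth a b Z n = y at *
  generalize energy a b Z f m = G at *
  generalize energy a b Z f n = K at *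
  have h2 : V * K ≤ 51 / 49 * (W * G) := by linarith
  have h3 := pow_le_pow_left₀ (by positivity) h2 5
  have h4 : (V * K) ^ 5 ≤ 2 * (W * G) ^ 5 := by
    refine h3.trans ?_
    rw [mul_pow]
    refine mul_le_mul_of_nonneg_right (by norm_num) (by positivity)
  have h5 := mul_le_mul_of_nonneg_right h4 (by positivity : 0 ≤ x ^ 2 * y ^ 2)
  calc K ^ 5 * x ^ 2 = (V * K) ^ 5 * (x ^ 2 * y ^ 2) := by
        linear_combination -(K ^ 5 * x ^ 2) * en
    _ ≤ 2 * (W * G) ^ 5 * (x ^ 2 * y ^ 2) := h5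
    _ = 2 * G ^ 5 * y ^ 2 := by linear_combination 2 * G ^ 5 * y ^ 2 * em

theorem sqrt_heightSq_sq (hf : IsThreeTermSolution a b Z f) :
    √(heightSq a b Z) ^ 2 = heightSq a b Z :=
  Real.sq_sqrt (by linarith [hf.half_le_heightSq])

theorem seven_tenths_le_sqrt (hf : IsThreeTermSolution a b Z f) :
    7 / 10 ≤ √(heightSq a b Z) :=
  Real.le_sqrt_of_sq_le (by have := hf.half_le_heightSq; norm_num; linarith)

/-- Points of depth at least `t ^ 2` are oscillatory if `t` is a large multiple of both `h ^ (1 / 2)`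
and `(h |T| / √Z) ^ (1 / 3)`, for the height `h` and `T = turningDiag a b Z`. The condition
`h / 2 ≤ m` excludes the region where `m` is small in comparison with the square root of the
depth. -/
theorem isOscillatory_of_le_depth (hf : IsThreeTermSolution a b Z f) {t : ℝ} (ht : 0 < t)
    (hZ : √(heightSq a b Z) ≤ Z) (ht2 : 10 ^ 4 * √(heightSq a b Z) ≤ t ^ 2)
    (ht3 : 10 ^ 6 * (√(heightSq a b Z) * |turningDiag a b Z|) ≤ t ^ 3 * √Z) {m : ℕ} (hma : m ≤ a)
    (hm : √(heightSq a b Z) ≤ 2 * m) (hd : t ^ 2 ≤ depth a b Z m) :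
    IsOscillatory a b Z m := by
  have hZ0 := hf.Z_pos
  have hx : 0 < depth a b Z m := lt_of_lt_of_le (by positivity) hd
  have hmh := natCast_le_sqrt_heightSq hx.le
  have hH := hf.sqrt_heightSq_sq
  have hh := hf.seven_tenths_le_sqrt
  have h4 := hf.four_mul_offDiag_sq (m := m) (by omega) (by omega)
  have hD := midDiag_eq a b Z m
  have hA := offDiag_nonneg a b m
  have hm0 : (0 : ℝ) ≤ m := Nat.cast_nonneg m
  have hxH : depth a b Z m ≤ heightSq a b Z := by
    rw [depth]; push_cast; nlinarith
  rw [← hH] at hxH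
  have hr := Real.sq_sqrt hZ0.le
  have hr0 : 0 < √Z := Real.sqrt_pos.mpr hZ0
  have hs := Real.sq_sqrt hx.le
  have hs0 : 0 < √(depth a b Z m) := Real.sqrt_pos.mpr hx
  have hts : t ≤ √(depth a b Z m) := Real.le_sqrt_of_sq_le hd
  have h5 : 100 * √(heightSq a b Z) ≤ √Z * √(depth a b Z m) := by
    refine le_of_abs_le (abs_le_of_sq_le_sq ?_ (by positivity))
    rw [mul_pow, mul_pow, hr, hs]
    calc 100 ^ 2 * √(heightSq a b Z) ^ 2 = √(heightSq a b Z) * (10 ^ 4 * √(heightSq a b Z)) := by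
          ring
      _ ≤ Z * depth a b Z m := mul_le_mul hZ (ht2.trans hd) (by positivity) hZ0.le
  refine ⟨hx, by linarith, ?_, by linarith, by nlinarith⟩
  have h6 : offDiag a b m ≤ |turningDiag a b Z| / 2 + depth a b Z m +
      √Z * √(depth a b Z m) := by
    have h7 : |midDiag a b Z m| ≤ |turningDiag a b Z| + 2 * depth a b Z m := by
      rw [hD]
      refine (abs_sub _ _).trans ?_
      rw [abs_of_nonneg (by linarith : 0 ≤ 2 * depth a b Z m)]
    have h8 : offDiag a b m ≤ |midDiag a b Z m| / 2 + √Z * √(depth a b Z m) := by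
      refine le_of_abs_le (abs_le_of_sq_le_sq ?_ (by positivity))
      have e : (√Z * √(depth a b Z m)) ^ 2 = Z * depth a b Z m := by rw [mul_pow, hr, hs]
      have e2 := sq_abs (midDiag a b Z m)
      have : 0 ≤ |midDiag a b Z m| * (√Z * √(depth a b Z m)) := by positivity
      nlinarith
    linarith
  have ht3' : t ^ 3 ≤ √(depth a b Z m) * depth a b Z m := by
    calc t ^ 3 ≤ √(depth a b Z m) ^ 3 := pow_le_pow_left₀ ht.le hts 3
      _ = √(depth a b Z m) * depth a b Z m := by rw [pow_succ', hs]
  generalize √(heightSq a b Z) = h at *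
  generalize |turningDiag a b Z| = d at *
  generalize √(depth a b Z m) = s at *
  generalize √Z = r at *
  generalize depth a b Z m = x at *
  have c1 : 10 ^ 6 * (h * d) ≤ s * x * r :=
    ht3.trans (mul_le_mul_of_nonneg_right ht3' hr0.le)
  have c2 : 100 * h * x ≤ r * s * x := mul_le_mul_of_nonneg_right h5 hx.le
  have c3 : 10 ^ 4 * h * (r * s) ≤ x * (r * s) :=
    mul_le_mul_of_nonneg_right (ht2.trans hd) (by positivity)
  have c4 : (m : ℝ) * offDiag a b m ≤ h * (d / 2 + x + r * s) :=
    mul_le_mul hmh h6 hA (by linarith)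
  have c5 : 0 ≤ r * s * x := by positivity
  linarith

/-- For `m ≤ h / 2`, where `h` is the height, `f m` is of size at most `h ^ (-1 / 2)`. -/
theorem sq_mul_sqrt_le (hf : IsThreeTermSolution a b Z f) (hh : 1 ≤ √(heightSq a b Z)) {m : ℕ}
    (hm : 2 * m ≤ √(heightSq a b Z)) (hma : m ≤ a) : f m ^ 2 * √(heightSq a b Z) ≤ 12 := by
  have h1 := hf.depth_mul_sq_le hma
  have h2 := hf.energy_anti (Nat.zero_le m) hma
  have h3 := hf.energy_zero_le
  have hH := hf.sqrt_heightSq_sq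
  have hZ := hf.Z_pos
  have h0 : (0 : ℝ) ≤ m := Nat.cast_nonneg m
  have h4 : √(heightSq a b Z) ^ 2 / 4 ≤ depth a b Z m := by
    rw [depth]; push_cast; nlinarith
  simp only [Nat.cast_zero] at h2
  generalize √(heightSq a b Z) = h at *
  have h5 : Z * (h ^ 2 / 4) * f m ^ 2 ≤ Z * depth a b Z m * f m ^ 2 := by gcongr
  have h6 : (Z * h / 4) * (f m ^ 2 * h) ≤ (Z * h / 4) * 12 := by linarith
  exact le_of_mul_le_mul_left h6 (by positivity)

/-- The energy in the upper half of the oscillatory region, from its bound at `⌈h / 2⌉`. -/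
theorem energy_pow_le (hf : IsThreeTermSolution a b Z f) {t : ℝ} (ht : 0 < t)
    (hZ : √(heightSq a b Z) ≤ Z) (ht2 : 10 ^ 4 * √(heightSq a b Z) ≤ t ^ 2)
    (ht3 : 10 ^ 6 * (√(heightSq a b Z) * |turningDiag a b Z|) ≤ t ^ 3 * √Z)
    (htH : 4 * t ^ 2 ≤ heightSq a b Z) {n : ℕ} (hna : n ≤ a)
    (hn : √(heightSq a b Z) ≤ 2 * n) (hd : t ^ 2 ≤ depth a b Z n) :
    energy a b Z f n ^ 5 ≤ 7776 * Z ^ 5 * √(heightSq a b Z) * depth a b Z n ^ 2 := by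
  have hZ0 := hf.Z_pos
  have hH := hf.sqrt_heightSq_sq
  have hh := hf.seven_tenths_le_sqrt
  obtain ⟨m, hm1, hm2, hmn⟩ : ∃ m : ℕ, √(heightSq a b Z) ≤ 2 * m ∧
      2 * m ≤ √(heightSq a b Z) + 2 ∧ m ≤ n := by
    refine ⟨⌈√(heightSq a b Z) / 2⌉₊, ?_, ?_, ?_⟩
    · have := Nat.le_ceil (√(heightSq a b Z) / 2); linarith
    · have := Nat.ceil_lt_add_one (a := √(heightSq a b Z) / 2) (by positivity); linarith
    · rw [Nat.ceil_le]; linarith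
  have hm0 : 1 ≤ m := by
    rcases Nat.eq_zero_or_pos m with rfl | h
    · norm_num at hm1; linarith
    · exact h
  have key := hf.energy_pow_mul_le hm0 hmn hna fun k hk1 hk2 ↦
    hf.isOscillatory_of_le_depth ht hZ ht2 ht3 (hk2.trans hna)
      (hm1.trans (by gcongr)) (hd.trans (depth_anti a b Z hk2))
  have h1 := hf.energy_anti (Nat.zero_le m) (hmn.trans hna)
  have h2 := hf.energy_zero_le
  simp only [Nat.cast_zero] at h1
  have h3 := hf.energy_nonneg (hmn.trans hna)
  have h4 : √(heightSq a b Z) ^ 2 / 4 ≤ depth a b Z m := by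
    rw [depth]; push_cast; nlinarith
  generalize √(heightSq a b Z) = h at *
  have h5 : energy a b Z f m ^ 5 ≤ (3 * Z * h) ^ 5 := pow_le_pow_left₀ h3 (h1.trans h2) 5
  have h6 : (h ^ 2 / 4) ^ 2 ≤ depth a b Z m ^ 2 := pow_le_pow_left₀ (by positivity) h4 2
  have h7 := mul_le_mul_of_nonneg_left h6 (pow_nonneg (hf.energy_nonneg hna) 5)
  have h8 := mul_le_mul_of_nonneg_right h5 (sq_nonneg (depth a b Z n))
  have h9 : (h ^ 4 / 16) * energy a b Z f n ^ 5 ≤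
      (h ^ 4 / 16) * (7776 * Z ^ 5 * h * depth a b Z n ^ 2) := by linarith
  exact le_of_mul_le_mul_left h9 (by positivity)

/-! ### The neighbourhood of the turning point -/

theorem offDiag_mul_sub_sq_le (hf : IsThreeTermSolution a b Z f) {m : ℕ} (hma : m ≤ a)
    (hm : 0 ≤ depth a b Z m) :
    offDiag a b m ^ 2 * (|f (m + 1)| - |f m|) ^ 2 ≤ energy a b Z f m := by
  have h := hf.four_mul_offDiag_sq (m := m) (by omega) (by omega)
  have hZ := hf.Z_pos
  have hA := offDiag_nonneg a b m
  have h1 : |midDiag a b Z m| ≤ 2 * offDiag a b m := by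
    refine abs_le_of_sq_le_sq ?_ (by positivity)
    have : 0 ≤ Z * depth a b Z m := by positivity
    linarith
  have h2 : midDiag a b Z m * (f m * f (m + 1)) ≤
      2 * offDiag a b m * (|f m| * |f (m + 1)|) := by
    refine (le_abs_self _).trans ?_
    rw [abs_mul, abs_mul]
    gcongr
  have h3 := mul_le_mul_of_nonneg_left h2 hA
  rw [energy, ← sq_abs (f m), ← sq_abs (f (m + 1))]
  linarith

theorem abs_turningDiag_le (hf : IsThreeTermSolution a b Z f) {m : ℕ} (hma : m ≤ a)
    (hm : 0 ≤ depth a b Z m) : |turningDiag a b Z| ≤ 2 * offDiag a b m := by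
  have h := hf.four_mul_offDiag_sq (m := m) (by omega) (by omega)
  have hT := hf.turningDiag_le
  refine abs_le_of_sq_le_sq ?_ (by linarith [offDiag_nonneg a b m])
  rw [midDiag_eq] at h
  have := mul_nonneg hm (sub_nonneg.mpr hT)
  have := sq_nonneg (depth a b Z m)
  nlinarith

/-- Beyond the turning point the recurrence is diagonally dominant. -/
theorem two_mul_offDiag_le_abs_midDiag (hf : IsThreeTermSolution a b Z f) {m : ℕ} (hma : m ≤ a)
    (hm : depth a b Z m ≤ 0) : 2 * offDiag a b m ≤ |midDiag a b Z m| := by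
  have h := hf.four_mul_offDiag_sq (m := m) (by omega) (by omega)
  have hZ := hf.Z_pos
  refine le_of_abs_le (abs_le_of_sq_le_sq ?_ (abs_nonneg _))
  rw [sq_abs]
  nlinarith

theorem midDiag_nonpos (hf : IsThreeTermSolution a b Z f) (hT : turningDiag a b Z < 0) {m : ℕ}
    (hma : m ≤ a) : midDiag a b Z m ≤ 0 := by
  have hZ := hf.Z_pos
  have hδ := sub_nonneg.mpr hf.casimir_le_casimir
  rw [hf.turningDiag_eq, div_lt_iff₀ (by positivity), zero_mul] at hT
  have h1 : Z < casimir b - casimir a := by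
    by_contra hcon
    push Not at hcon
    nlinarith
  have h2 : (m : ℝ) * (m + 1) ≤ casimir a := by
    have : (m : ℝ) ≤ a := by exact_mod_cast hma
    unfold casimir; gcongr
  rw [midDiag]
  push_cast
  linarith

theorem offDiag_add_offDiag_le (hf : IsThreeTermSolution a b Z f) {m : ℕ} (hma : m + 1 ≤ a)
    (hm : depth a b Z m ≤ 0) :
    offDiag a b (m + 1 : ℕ) + offDiag a b m ≤
      |Z - casimir a - casimir b + 2 * ((m : ℝ) + 1) ^ 2| := by
  have hm' := (depth_anti a b Z (Nat.le_succ m)).trans hm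
  have h1 := hf.two_mul_offDiag_le_abs_midDiag (by omega) hm
  have h2 := hf.two_mul_offDiag_le_abs_midDiag hma hm'
  have e : Z - casimir a - casimir b + 2 * ((m : ℝ) + 1) ^ 2 =
      (midDiag a b Z (m + 1 : ℕ) + midDiag a b Z m) / 2 := by
    rw [midDiag, midDiag]; push_cast; ring
  rw [e]
  rcases le_or_gt 0 (turningDiag a b Z) with hT | hT
  · have p1 : 0 ≤ midDiag a b Z m := by rw [midDiag_eq]; linarith
    have p2 : 0 ≤ midDiag a b Z (m + 1 : ℕ) := by rw [midDiag_eq]; linarith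
    rw [abs_of_nonneg p1] at h1
    rw [abs_of_nonneg p2] at h2
    rw [abs_of_nonneg (by linarith)]
    linarith
  · have p1 := hf.midDiag_nonpos hT (m := m) (by omega)
    have p2 := hf.midDiag_nonpos hT hma
    rw [abs_of_nonpos p1] at h1
    rw [abs_of_nonpos p2] at h2
    rw [abs_of_nonpos (by linarith)]
    linarith

/-- Beyond the turning point `|f|` decreases. -/
theorem abs_succ_le_of_depth_nonpos (hf : IsThreeTermSolution a b Z f) {m : ℕ}
    (hma : m + 1 ≤ a) (hm : depth a b Z m ≤ 0) : |f (m + 1)| ≤ |f m| := by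
  have step : ∀ m : ℕ, m + 1 ≤ a → depth a b Z m ≤ 0 → |f (m + 2)| ≤ |f (m + 1)| →
      |f (m + 1)| ≤ |f m| := by
    intro m hma hm h
    have h1 := hf.offDiag_add_offDiag_le hma hm
    have r := congrArg abs (hf.recurrence (m + 1 : ℕ))
    push_cast at r h1
    rw [add_sub_cancel_right, show (m : ℤ) + 1 + 1 = m + 2 by ring, abs_mul] at r
    have h2 := abs_add_le (offDiag a b (m + 1) * f (m + 2)) (offDiag a b m * f m)
    rw [abs_mul, abs_mul, abs_of_nonneg (offDiag_nonneg _ _ _),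
      abs_of_nonneg (offDiag_nonneg _ _ _)] at h2
    have h3 := mul_le_mul_of_nonneg_left h (offDiag_nonneg a b (m + 1))
    have h4 := mul_le_mul_of_nonneg_right h1 (abs_nonneg (f (m + 1)))
    have h5 : offDiag a b m * |f (m + 1)| ≤ offDiag a b m * |f m| := by linarith
    exact le_of_mul_le_mul_left h5 (offDiag_pos hf.le (by omega) (by omega))
  obtain ⟨k, hk⟩ := Nat.exists_eq_add_of_le hma
  induction k generalizing m with
  | zero =>
    refine step m hma hm ?_
    rw [hf.support (m + 2) (by rw [abs_le]; omega), abs_zero]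
    exact abs_nonneg _
  | succ k ih =>
    refine step m hma hm ?_
    have := ih (m := m + 1) (by omega) ((depth_anti a b Z (Nat.le_succ m)).trans hm) (by omega)
    push_cast at this
    rwa [add_assoc] at this

/-- The change of `|f|` up to and beyond the turning point. -/
theorem abs_le_add_of_le (hf : IsThreeTermSolution a b Z f) (hT : turningDiag a b Z ≠ 0)
    {n k : ℕ} (hnk : n ≤ k) (hk : k ≤ a) {K : ℝ} (hK0 : 0 ≤ K)
    (hK : √(heightSq a b Z) + 1 - n ≤ K) :
    |f k| ≤ |f n| + K * (2 * √(energy a b Z f n) / |turningDiag a b Z|) := by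
  have hT' : 0 < |turningDiag a b Z| := abs_pos.mpr hT
  set ε := 2 * √(energy a b Z f n) / |turningDiag a b Z| with hε
  have hε0 : 0 ≤ ε := by positivity
  have step : ∀ j, n ≤ j → j ≤ a → 0 ≤ depth a b Z j → |f (j + 1)| ≤ |f j| + ε := by
    intro j hnj hj hd
    have h1 := hf.offDiag_mul_sub_sq_le hj hd
    have h2 := hf.abs_turningDiag_le hj hd
    have h3 := hf.energy_anti hnj hj
    have h4 : offDiag a b j * (|f (j + 1)| - |f j|) ≤ √(energy a b Z f n) := by
      refine Real.le_sqrt_of_sq_le ?_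
      rw [mul_pow]; linarith
    by_contra hcon
    push Not at hcon
    have h5 : ε * |turningDiag a b Z| = 2 * √(energy a b Z f n) := by rw [hε]; field_simp
    have h6 : ε < |f (j + 1)| - |f j| := by linarith
    have h7 : |turningDiag a b Z| * ε < |turningDiag a b Z| * (|f (j + 1)| - |f j|) :=
      mul_lt_mul_of_pos_left h6 hT'
    have h8 : |turningDiag a b Z| * (|f (j + 1)| - |f j|) ≤
        2 * offDiag a b j * (|f (j + 1)| - |f j|) :=
      mul_le_mul_of_nonneg_right h2 (by linarith)
    linarith
  have linear : ∀ j, n ≤ j → j ≤ a → (n < j → 0 ≤ depth a b Z (j - 1 : ℕ)) →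
      |f j| ≤ |f n| + ((j : ℝ) - n) * ε := by
    intro j hnj
    induction j, hnj using Nat.le_induction with
    | base => intro _ _; simp
    | succ j hnj ih =>
      intro hj hd
      have hd' := hd (by omega)
      rw [Nat.add_sub_cancel] at hd'
      have h1 := ih (by omega) fun _ ↦ hd'.trans (depth_anti a b Z (by omega))
      have h2 := step j hnj (by omega) hd'
      push_cast
      linarith
  induction k, hnk using Nat.le_induction with
  | base => have : 0 ≤ K * ε := by positivity
            linarith
  | succ j hnj ih =>
    rcases le_or_gt 0 (depth a b Z j) with hd | hd
    · have h1 := linear (j + 1) (by omega) hk fun _ ↦ hd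
      have h2 := natCast_le_sqrt_heightSq hd
      refine h1.trans ?_
      have : ((j + 1 : ℕ) : ℝ) - n ≤ K := by push_cast; linarith
      gcongr
    · have := hf.abs_succ_le_of_depth_nonpos hk hd.le
      push_cast
      exact this.trans (ih (by omega))

end IsThreeTermSolution

/-! ### The pointwise bound -/

namespace IsThreeTermSolution

variable {a b : ℕ} {Z : ℝ} {f : ℤ → ℝ}

/-- The last point `n` of depth at least `t ^ 2`, where the transition region begins. -/
theorem exists_last_le_depth (hf : IsThreeTermSolution a b Z f) {t : ℝ} (ht : 0 < t)
    (hh : 10 ≤ √(heightSq a b Z)) (htH : 4 * t ^ 2 ≤ heightSq a b Z) :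
    ∃ n : ℕ, n + 1 ≤ a ∧ t ^ 2 ≤ depth a b Z n ∧ depth a b Z (n + 1 : ℕ) < t ^ 2 ∧
      √(heightSq a b Z) ≤ 2 * n := by
  have hH := hf.sqrt_heightSq_sq
  have ht2 : 0 < t ^ 2 := by positivity
  have ha : depth a b Z a < t ^ 2 := by
    have := hf.heightSq_le_casimir
    rw [casimir] at this
    rw [depth]; push_cast; linarith
  obtain ⟨m, hm1, hm2⟩ : ∃ m : ℕ, √(heightSq a b Z) ≤ 2 * m ∧
      2 * m ≤ √(heightSq a b Z) + 2 := by
    refine ⟨⌈√(heightSq a b Z) / 2⌉₊, ?_, ?_⟩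
    · have := Nat.le_ceil (√(heightSq a b Z) / 2); linarith
    · have := Nat.ceil_lt_add_one (a := √(heightSq a b Z) / 2) (by positivity); linarith
  have hm3 : t ^ 2 ≤ depth a b Z m := by
    rw [depth]; push_cast; nlinarith
  have hma : m ≤ a := by
    by_contra hcon
    push Not at hcon
    linarith [depth_anti a b Z hcon.le]
  classical
  let P : ℕ → Prop := fun n ↦ t ^ 2 ≤ depth a b Z n
  have h1 : P (Nat.findGreatest P a) := Nat.findGreatest_spec (P := P) hma hm3
  have h2 : m ≤ Nat.findGreatest P a := Nat.le_findGreatest hma hm3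
  have h3 : Nat.findGreatest P a ≤ a := Nat.findGreatest_le a
  have h4 : Nat.findGreatest P a ≠ a := by
    intro h
    rw [h] at h1
    exact absurd ha (not_lt.mpr h1)
  refine ⟨Nat.findGreatest P a, by omega, h1, ?_, ?_⟩
  · by_contra hcon
    push Not at hcon
    exact Nat.findGreatest_is_greatest (P := P) (Nat.lt_succ_self _) (by omega) hcon
  · have : (m : ℝ) ≤ (Nat.findGreatest P a : ℕ) := by exact_mod_cast h2
    linarith

/-- The bound for `f` between half the height and the transition region. -/
theorem sq_pow_mul_pow_le (hf : IsThreeTermSolution a b Z f) {t : ℝ} (ht : 0 < t)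
    (hZ : √(heightSq a b Z) ≤ Z) (ht2 : 10 ^ 4 * √(heightSq a b Z) ≤ t ^ 2)
    (ht3 : 10 ^ 6 * (√(heightSq a b Z) * |turningDiag a b Z|) ≤ t ^ 3 * √Z)
    (htH : 4 * t ^ 2 ≤ heightSq a b Z) {n : ℕ} (hna : n ≤ a)
    (hn : √(heightSq a b Z) ≤ 2 * n) (hd : t ^ 2 ≤ depth a b Z n) :
    (f n ^ 2) ^ 5 * t ^ 6 ≤ 7776 * √(heightSq a b Z) := by
  have h1 := hf.energy_pow_le ht hZ ht2 ht3 htH hna hn hd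
  have h2 := hf.depth_mul_sq_le hna
  have hZ0 := hf.Z_pos
  have hx : 0 < depth a b Z n := lt_of_lt_of_le (by positivity) hd
  have h3 := (pow_le_pow_left₀ (by positivity) h2 5).trans h1
  generalize √(heightSq a b Z) = h at *
  generalize depth a b Z n = x at *
  have h4 : (Z ^ 5 * x ^ 2) * ((f n ^ 2) ^ 5 * x ^ 3) ≤ (Z ^ 5 * x ^ 2) * (7776 * h) := by
    linarith
  have h5 := le_of_mul_le_mul_left h4 (by positivity)
  have h6 := pow_le_pow_left₀ (by positivity) hd 3
  have h7 := mul_le_mul_of_nonneg_left h6 (by positivity : 0 ≤ (f n ^ 2) ^ 5)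
  linarith

theorem sq_le_one (hf : IsThreeTermSolution a b Z f) {k : ℕ} (hk : k ≤ a) : f k ^ 2 ≤ 1 :=
  (Finset.single_le_sum (f := fun m : ℤ ↦ f m ^ 2) (fun _ _ ↦ sq_nonneg _)
    (Finset.mem_Icc.mpr ⟨by omega, by omega⟩)).trans hf.norm

/-- When `turningDiag` is small, the width of the transition region near the turning point is of
order `1`. -/
theorem sq_pow_mul_sq_le_of_sq_le (hf : IsThreeTermSolution a b Z f)
    (hZ : √(heightSq a b Z) ≤ Z) (hT : turningDiag a b Z ^ 2 ≤ √(heightSq a b Z) * Z) {k : ℕ}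
    (hk : k ≤ a) : (f k ^ 2) ^ 5 * √(heightSq a b Z) ^ 2 ≤ 10 ^ 13 := by
  have hH := hf.sqrt_heightSq_sq
  have hh := hf.seven_tenths_le_sqrt
  have hZ0 := hf.Z_pos
  have hq0 : 0 ≤ f k ^ 2 := sq_nonneg _
  have hq := hf.sq_le_one hk
  set t := 100 * √(√(heightSq a b Z)) with ht_def
  have hsq : √(√(heightSq a b Z)) ^ 2 = √(heightSq a b Z) := Real.sq_sqrt (by linarith)
  have ht : 0 < t := by positivity
  have ht2 : t ^ 2 = 10 ^ 4 * √(heightSq a b Z) := by rw [ht_def, mul_pow, hsq]; norm_num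
  have ht3 : 10 ^ 6 * (√(heightSq a b Z) * |turningDiag a b Z|) ≤ t ^ 3 * √Z := by
    have h1 : |turningDiag a b Z| ≤ √(√(heightSq a b Z)) * √Z := by
      rw [← Real.sqrt_mul (by linarith), ← Real.sqrt_sq_eq_abs]
      exact Real.sqrt_le_sqrt hT
    calc _ ≤ 10 ^ 6 * (√(heightSq a b Z) * (√(√(heightSq a b Z)) * √Z)) := by gcongr
      _ = t ^ 2 * t * √Z := by rw [ht2, ht_def]; ring
      _ = t ^ 3 * √Z := by ring
  rcases lt_or_ge (heightSq a b Z) (4 * t ^ 2) with hlt | hge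
  · -- here the height is bounded by an absolute constant
    rw [ht2] at hlt
    have h1 : √(heightSq a b Z) ≤ 4 * 10 ^ 4 := by nlinarith
    have h2 : (f k ^ 2) ^ 5 ≤ 1 := pow_le_one₀ hq0 hq
    calc (f k ^ 2) ^ 5 * √(heightSq a b Z) ^ 2 ≤ 1 * (4 * 10 ^ 4) ^ 2 := by gcongr
      _ ≤ 10 ^ 13 := by norm_num
  have hh' : 10 ≤ √(heightSq a b Z) := by
    rw [ht2] at hge
    nlinarith
  obtain ⟨n, hna, hn1, hn2, hn3⟩ := hf.exists_last_le_depth ht hh' hge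
  rcases lt_or_ge (2 * (k : ℝ)) (√(heightSq a b Z)) with h1 | h1
  · have h2 := hf.sq_mul_sqrt_le (by linarith) h1.le hk
    have h3 : (f k ^ 2) ^ 3 ≤ 1 := pow_le_one₀ hq0 hq
    calc (f k ^ 2) ^ 5 * √(heightSq a b Z) ^ 2 =
          (f k ^ 2) ^ 3 * (f k ^ 2 * √(heightSq a b Z)) ^ 2 := by ring
      _ ≤ 1 * 12 ^ 2 := by gcongr
      _ ≤ _ := by norm_num
  rcases le_or_gt (t ^ 2) (depth a b Z k) with h2 | h2
  · have h3 := hf.sq_pow_mul_pow_le ht hZ ht2.ge ht3 hge hk h1 h2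
    have e : t ^ 6 = (10 ^ 4 * √(heightSq a b Z)) ^ 3 := by rw [← ht2]; ring
    rw [e] at h3
    have h4 : √(heightSq a b Z) * (10 ^ 12 * ((f k ^ 2) ^ 5 * √(heightSq a b Z) ^ 2)) ≤
        √(heightSq a b Z) * 7776 := by linarith
    have h5 := le_of_mul_le_mul_left h4 (by linarith)
    linarith
  · have hnk : n < k := by
      by_contra hcon
      push Not at hcon
      linarith [depth_anti a b Z hcon]
    have h3 := hf.sq_le_energy_of_lt hnk hk
    have h4 := hf.energy_pow_le ht hZ ht2.ge ht3 hge (by omega : n ≤ a) hn3 hn1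
    have h5 := depth_le_two_mul_sq (by linarith) ht2.ge hn1 hn2
    have h6 : 0 ≤ depth a b Z n := (sq_nonneg t).trans hn1
    have h7 := pow_le_pow_left₀ h6 h5 2
    rw [ht2] at h7
    generalize √(heightSq a b Z) = h at *
    have h8 : Z * h * f k ^ 2 ≤ energy a b Z f n := by
      refine le_trans ?_ h3
      have : (Z * f k ^ 2) * h ≤ (Z * f k ^ 2) * (2 * k) :=
        mul_le_mul_of_nonneg_left h1 (by positivity)
      linarith
    have h9 := (pow_le_pow_left₀ (by positivity) h8 5).trans h4
    have h10 := mul_le_mul_of_nonneg_left h7 (by positivity : 0 ≤ 7776 * Z ^ 5 * h)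
    have h11 : (Z ^ 5 * h ^ 3) * ((f k ^ 2) ^ 5 * h ^ 2) ≤
        (Z ^ 5 * h ^ 3) * (7776 * (4 * 10 ^ 8)) := by linarith
    have h12 := le_of_mul_le_mul_left h11 (by positivity)
    linarith

/-- The bound in the transition region, when it is wide. -/
theorem sq_pow_mul_le_of_lt_sq (hf : IsThreeTermSolution a b Z f)
    (hZ : √(heightSq a b Z) ≤ Z) (hT : √(heightSq a b Z) * Z < turningDiag a b Z ^ 2) {t : ℝ}
    (ht : 0 < t)
    (ht3 : t ^ 3 * √Z = 10 ^ 6 * (√(heightSq a b Z) * |turningDiag a b Z|))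
    (htH : 4 * t ^ 2 ≤ heightSq a b Z) {k : ℕ} (hk : k ≤ a) :
    (f k ^ 2) ^ 5 * (√(heightSq a b Z) * turningDiag a b Z ^ 2) ≤ 10 ^ 70 * Z := by
  have hH := hf.sqrt_heightSq_sq
  have hh := hf.seven_tenths_le_sqrt
  have hZ0 := hf.Z_pos
  have hq0 : 0 ≤ f k ^ 2 := sq_nonneg _
  have hr := Real.sq_sqrt hZ0.le
  have ht6 : t ^ 6 * Z = 10 ^ 12 * (√(heightSq a b Z) ^ 2 * turningDiag a b Z ^ 2) := by
    rw [← sq_abs (turningDiag a b Z)]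
    calc t ^ 6 * Z = (t ^ 3 * √Z) ^ 2 := by rw [mul_pow, hr]; ring
      _ = _ := by rw [ht3]; ring
  have ht2 : 10 ^ 4 * √(heightSq a b Z) ≤ t ^ 2 := by
    have h1 : (10 ^ 4 * √(heightSq a b Z)) ^ 3 ≤ (t ^ 2) ^ 3 := by
      have h2 : Z * (10 ^ 4 * √(heightSq a b Z)) ^ 3 ≤ Z * (t ^ 2) ^ 3 := by
        have h3 := mul_le_mul_of_nonneg_left hT.le
          (by positivity : 0 ≤ 10 ^ 12 * √(heightSq a b Z) ^ 2)
        linarith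
      exact le_of_mul_le_mul_left h2 hZ0
    exact le_of_pow_le_pow_left₀ (by norm_num) (by positivity) h1
  have hh' : 10 ≤ √(heightSq a b Z) := by
    nlinarith
  have hT2 : 0 < turningDiag a b Z ^ 2 := lt_of_le_of_lt (by positivity) hT
  have hT0 : turningDiag a b Z ≠ 0 := fun h ↦ by rw [h] at hT2; norm_num at hT2
  have upper : ∀ n : ℕ, n ≤ a → √(heightSq a b Z) ≤ 2 * n → t ^ 2 ≤ depth a b Z n →
      10 ^ 12 * ((f n ^ 2) ^ 5 * (√(heightSq a b Z) * turningDiag a b Z ^ 2)) ≤ 7776 * Z := by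
    intro n hna h1 h2
    have h3 := hf.sq_pow_mul_pow_le ht hZ ht2 ht3.ge htH hna h1 h2
    have h4 := mul_le_mul_of_nonneg_right h3 hZ0.le
    have h5 : (f n ^ 2) ^ 5 * t ^ 6 * Z = (f n ^ 2) ^ 5 *
      (10 ^ 12 * (√(heightSq a b Z) ^ 2 * turningDiag a b Z ^ 2)) := by rw [mul_assoc, ht6]
    rw [h5] at h4
    have h6 : √(heightSq a b Z) *
        (10 ^ 12 * ((f n ^ 2) ^ 5 * (√(heightSq a b Z) * turningDiag a b Z ^ 2))) ≤
        √(heightSq a b Z) * (7776 * Z) := by linarith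
    exact le_of_mul_le_mul_left h6 (by linarith)
  obtain ⟨n, hna, hn1, hn2, hn3⟩ := hf.exists_last_le_depth ht hh' htH
  rcases lt_or_ge (2 * (k : ℝ)) (√(heightSq a b Z)) with h1 | h1
  · have h2 := hf.sq_mul_sqrt_le (by linarith) h1.le hk
    have h3 : 10 ^ 12 * (√(heightSq a b Z) ^ 2 * turningDiag a b Z ^ 2) ≤
        √(heightSq a b Z) ^ 6 * Z := by
      rw [← ht6]
      have h4 : t ^ 2 ≤ √(heightSq a b Z) ^ 2 := by rw [hH]; nlinarith
      have h5 := pow_le_pow_left₀ (by positivity) h4 3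
      refine mul_le_mul_of_nonneg_right ?_ hZ0.le
      linarith
    have h4 := pow_le_pow_left₀ (by positivity) h2 5
    generalize √(heightSq a b Z) = h at *
    have h5 : h ^ 2 * turningDiag a b Z ^ 2 ≤ h ^ 2 * (h ^ 4 * Z) := by
      have : 0 ≤ h ^ 6 * Z := by positivity
      have : 0 ≤ h ^ 2 * turningDiag a b Z ^ 2 := by positivity
      linarith
    have h6 := le_of_mul_le_mul_left h5 (by positivity)
    calc (f k ^ 2) ^ 5 * (h * turningDiag a b Z ^ 2) ≤ (f k ^ 2) ^ 5 * (h * (h ^ 4 * Z)) := by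
          gcongr
      _ = (f k ^ 2 * h) ^ 5 * Z := by ring
      _ ≤ 12 ^ 5 * Z := by gcongr
      _ ≤ _ := by linarith
  rcases le_or_gt (t ^ 2) (depth a b Z k) with h2 | h2
  · have := upper k hk h1 h2
    have : 0 ≤ (f k ^ 2) ^ 5 * (√(heightSq a b Z) * turningDiag a b Z ^ 2) := by positivity
    linarith
  · have hnk : n < k := by
      by_contra hcon
      push Not at hcon
      linarith [depth_anti a b Z hcon]
    have h4 := hf.energy_pow_le ht hZ ht2 ht3.ge htH (by omega : n ≤ a) hn3 hn1
    have h5 := depth_le_two_mul_sq (by linarith) ht2 hn1 hn2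
    have h6 : 0 ≤ depth a b Z n := (sq_nonneg t).trans hn1
    have h7 := pow_le_pow_left₀ h6 h5 2
    have hup := upper n (by omega) hn3 hn1
    have hG := hf.energy_nonneg (by omega : n ≤ a)
    -- the number of steps from `n` to the turning point
    have hK : √(heightSq a b Z) + 1 - n ≤ 4 * t ^ 2 / √(heightSq a b Z) := by
      rw [le_div_iff₀ (by linarith)]
      have h8 := natCast_le_sqrt_heightSq h6
      rw [depth] at h5
      push_cast at h5
      have h9 : (0 : ℝ) ≤ n := Nat.cast_nonneg n
      nlinarith
    have h8 := hf.abs_le_add_of_le hT0 hnk.le hk (by positivity) hK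
    have h9 : f k ^ 2 ≤ 2 * f n ^ 2 + 128 * (t ^ 4 * energy a b Z f n /
        (√(heightSq a b Z) ^ 2 * turningDiag a b Z ^ 2)) := by
      have h10 := pow_le_pow_left₀ (abs_nonneg _) h8 2
      rw [sq_abs] at h10
      refine h10.trans ((add_sq_le).trans ?_)
      rw [sq_abs, mul_add]
      refine add_le_add_right (le_of_eq ?_) _
      simp only [mul_pow, div_pow, sq_abs, Real.sq_sqrt hG]
      field_simp
      ring
    have h10 := pow_le_pow_left₀ hq0 h9 5
    have h11 := h10.trans (add_pow_le (by positivity) (by positivity) 5)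
    have ht24 : t ^ 24 * Z ^ 4 = 10 ^ 48 * (√(heightSq a b Z) ^ 8 * turningDiag a b Z ^ 8) := by
      calc _ = (t ^ 6 * Z) ^ 4 := by ring
        _ = _ := by rw [ht6]; ring
    generalize √(heightSq a b Z) = h at *
    generalize turningDiag a b Z = T at *
    have h12 : (t ^ 4 * energy a b Z f n / (h ^ 2 * T ^ 2)) ^ 5 * (h * T ^ 2) ≤
        31104 * 10 ^ 48 * Z := by
      have h13 : energy a b Z f n ^ 5 ≤ 31104 * Z ^ 5 * h * t ^ 4 := by
        refine h4.trans ?_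
        have := mul_le_mul_of_nonneg_left h7 (by positivity : 0 ≤ 7776 * Z ^ 5 * h)
        linarith
      rw [div_pow, div_mul_eq_mul_div, div_le_iff₀ (by positivity)]
      calc (t ^ 4 * energy a b Z f n) ^ 5 * (h * T ^ 2) =
            energy a b Z f n ^ 5 * (t ^ 20 * h * T ^ 2) := by ring
        _ ≤ 31104 * Z ^ 5 * h * t ^ 4 * (t ^ 20 * h * T ^ 2) := by gcongr
        _ = 31104 * (t ^ 24 * Z ^ 4) * Z * h ^ 2 * T ^ 2 := by ring
        _ = 31104 * 10 ^ 48 * Z * (h ^ 2 * T ^ 2) ^ 5 := by rw [ht24]; ring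
    have h14 := mul_le_mul_of_nonneg_right h11 (by positivity : 0 ≤ h * T ^ 2)
    norm_num [mul_pow] at h14 hup h12 ⊢
    linarith

/-- The bound when the transition region reaches down to the origin. -/
theorem sq_mul_sqrt_le_of_heightSq_lt (hf : IsThreeTermSolution a b Z f)
    (hT : turningDiag a b Z ≠ 0) {t : ℝ}
    (ht3 : t ^ 3 * √Z = 10 ^ 6 * (√(heightSq a b Z) * |turningDiag a b Z|))
    (htH : heightSq a b Z < 4 * t ^ 2) {k : ℕ} (hk : k ≤ a) :
    f k ^ 2 * √(heightSq a b Z) ≤ 10 ^ 17 := by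
  have hH := hf.sqrt_heightSq_sq
  have hh := hf.seven_tenths_le_sqrt
  have hZ0 := hf.Z_pos
  have hr := Real.sq_sqrt hZ0.le
  have hT2 : 0 < turningDiag a b Z ^ 2 := by positivity
  have hE := hf.energy_zero_le
  have hE0 : 0 ≤ energy a b Z f 0 := by exact_mod_cast hf.energy_nonneg (Nat.zero_le a)
  have h0 : Z * heightSq a b Z * f 0 ^ 2 ≤ energy a b Z f 0 := by
    have := hf.depth_mul_sq_le (Nat.zero_le a)
    simpa [depth] using this
  have ht6 : t ^ 6 * Z = 10 ^ 12 * (√(heightSq a b Z) ^ 2 * turningDiag a b Z ^ 2) := by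
    rw [← sq_abs (turningDiag a b Z)]
    calc t ^ 6 * Z = (t ^ 3 * √Z) ^ 2 := by rw [mul_pow, hr]; ring
      _ = _ := by rw [ht3]; ring
  have h8 := hf.abs_le_add_of_le hT (Nat.zero_le k) hk (K := √(heightSq a b Z) + 1)
    (by positivity) (by simp)
  rw [Nat.cast_zero] at h8
  have h9 : f k ^ 2 ≤ 2 * f 0 ^ 2 +
      8 * ((√(heightSq a b Z) + 1) ^ 2 * energy a b Z f 0 / turningDiag a b Z ^ 2) := by
    have h10 := pow_le_pow_left₀ (abs_nonneg _) h8 2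
    rw [sq_abs] at h10
    refine h10.trans ((add_sq_le).trans ?_)
    rw [sq_abs, mul_add]
    refine add_le_add_right (le_of_eq ?_) _
    simp only [mul_pow, div_pow, sq_abs, Real.sq_sqrt hE0]
    ring
  rw [← hH] at h0 htH
  generalize √(heightSq a b Z) = h at *
  generalize turningDiag a b Z = T at *
  have h1 : f 0 ^ 2 * h ≤ 3 := by
    have : (Z * h) * (f 0 ^ 2 * h) ≤ (Z * h) * 3 := by linarith
    exact le_of_mul_le_mul_left this (by positivity)
  have h2 : h ^ 4 * Z ≤ 64 * 10 ^ 12 * T ^ 2 := by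
    have h3 := pow_le_pow_left₀ (by positivity) htH.le 3
    have h4 := mul_le_mul_of_nonneg_right h3 hZ0.le
    have h5 : h ^ 2 * (h ^ 4 * Z) ≤ h ^ 2 * (64 * 10 ^ 12 * T ^ 2) := by
      calc h ^ 2 * (h ^ 4 * Z) = (h ^ 2) ^ 3 * Z := by ring
        _ ≤ (4 * t ^ 2) ^ 3 * Z := h4
        _ = 64 * (t ^ 6 * Z) := by ring
        _ = _ := by rw [ht6]; ring
    exact le_of_mul_le_mul_left h5 (by positivity)
  have h3 : (h + 1) ^ 2 * energy a b Z f 0 / T ^ 2 * h ≤ 27 * 64 * 10 ^ 12 := by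
    rw [div_mul_eq_mul_div, div_le_iff₀ hT2]
    calc (h + 1) ^ 2 * energy a b Z f 0 * h ≤ (3 * h) ^ 2 * (3 * Z * h) * h := by
          gcongr; linarith
      _ = 27 * (h ^ 4 * Z) := by ring
      _ ≤ _ := by linarith
  have h4 := mul_le_mul_of_nonneg_right h9 (by linarith : 0 ≤ h)
  linarith

/-- The bound `f k ^ 2 ≤ C * a ^ (-2 / 5)`, to the fifth power. -/
theorem sq_pow_mul_sq_le (hf : IsThreeTermSolution a b Z f) (hZ : √(heightSq a b Z) ≤ Z) {k : ℕ}
    (hk : k ≤ a) : (f k ^ 2) ^ 5 * (a : ℝ) ^ 2 ≤ 10 ^ 71 := by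
  have hH := hf.sqrt_heightSq_sq
  have hh := hf.seven_tenths_le_sqrt
  have hZ0 := hf.Z_pos
  have hq0 : 0 ≤ f k ^ 2 := sq_nonneg _
  have hq := hf.sq_le_one hk
  have ha0 : (0 : ℝ) ≤ a := Nat.cast_nonneg a
  have ha2 : (a : ℝ) ^ 2 * Z ≤ √(heightSq a b Z) ^ 2 * Z + turningDiag a b Z ^ 2 := by
    have := hf.casimir_le_heightSq_add
    rw [casimir] at this
    rw [hH]
    nlinarith [mul_nonneg ha0 hZ0.le]
  rcases le_or_gt (turningDiag a b Z ^ 2) (√(heightSq a b Z) * Z) with hT | hT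
  · -- the height is comparable to `a`
    have h1 := hf.sq_pow_mul_sq_le_of_sq_le hZ hT hk
    generalize √(heightSq a b Z) = h at *
    have h2 : (a : ℝ) ^ 2 ≤ 3 * h ^ 2 := by
      have : (a : ℝ) ^ 2 * Z ≤ (h ^ 2 + h) * Z := by linarith
      have := le_of_mul_le_mul_right this hZ0
      nlinarith
    calc (f k ^ 2) ^ 5 * (a : ℝ) ^ 2 ≤ (f k ^ 2) ^ 5 * (3 * h ^ 2) := by gcongr
      _ = 3 * ((f k ^ 2) ^ 5 * h ^ 2) := by ring
      _ ≤ 3 * 10 ^ 13 := by gcongr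
      _ ≤ _ := by norm_num
  · have hT2 : 0 < turningDiag a b Z ^ 2 := lt_of_le_of_lt (by positivity) hT
    have hT0 : turningDiag a b Z ≠ 0 := fun h ↦ by rw [h] at hT2; norm_num at hT2
    -- `t ^ 2` is the depth at which the transition region begins
    obtain ⟨t, ht, ht3⟩ : ∃ t : ℝ, 0 < t ∧
        t ^ 3 * √Z = 10 ^ 6 * (√(heightSq a b Z) * |turningDiag a b Z|) := by
      have hZr : 0 < √Z := Real.sqrt_pos.mpr hZ0
      have hy : 0 < 10 ^ 6 * (√(heightSq a b Z) * |turningDiag a b Z|) / √Z :=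
        div_pos (mul_pos (by norm_num) (mul_pos (by linarith) (abs_pos.mpr hT0))) hZr
      refine ⟨_, Real.rpow_pos_of_pos hy (((3 : ℕ) : ℝ)⁻¹), ?_⟩
      rw [Real.rpow_inv_natCast_pow hy.le (by norm_num), div_mul_cancel₀ _ hZr.ne']
    rcases lt_or_ge (heightSq a b Z) (4 * t ^ 2) with hlt | hge
    · have h1 := hf.sq_mul_sqrt_le_of_heightSq_lt hT0 ht3 hlt hk
      have h2 : (a : ℝ) ≤ 2 * √(heightSq a b Z) ^ 2 := by
        rw [hH]; linarith [hf.half_natCast_le_heightSq]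
      generalize √(heightSq a b Z) = h at *
      calc (f k ^ 2) ^ 5 * (a : ℝ) ^ 2 ≤ (f k ^ 2) ^ 5 * (2 * h ^ 2) ^ 2 := by gcongr
        _ = 4 * f k ^ 2 * (f k ^ 2 * h) ^ 4 := by ring
        _ ≤ 4 * 1 * (10 ^ 17) ^ 4 := by gcongr
        _ ≤ _ := by norm_num
    · have h1 := hf.sq_pow_mul_le_of_lt_sq hZ hT ht ht3 hge hk
      generalize √(heightSq a b Z) = h at *
      have h2 : (a : ℝ) ^ 2 * Z ≤ 3 * (h * turningDiag a b Z ^ 2) := by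
        have := mul_le_mul_of_nonneg_left hT.le (by linarith : 0 ≤ h)
        nlinarith
      have h3 : ((f k ^ 2) ^ 5 * (a : ℝ) ^ 2) * Z ≤ (3 * 10 ^ 70) * Z := by
        calc ((f k ^ 2) ^ 5 * (a : ℝ) ^ 2) * Z = (f k ^ 2) ^ 5 * ((a : ℝ) ^ 2 * Z) := by ring
          _ ≤ (f k ^ 2) ^ 5 * (3 * (h * turningDiag a b Z ^ 2)) := by gcongr
          _ = 3 * ((f k ^ 2) ^ 5 * (h * turningDiag a b Z ^ 2)) := by ring
          _ ≤ 3 * (10 ^ 70 * Z) := by gcongr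
          _ = _ := by ring
      have h4 := le_of_mul_le_mul_right h3 hZ0
      linarith

/-- The recurrence is invariant under reflection. -/
theorem comp_neg (hf : IsThreeTermSolution a b Z f) :
    IsThreeTermSolution a b Z (fun m ↦ f (-m)) where
  one_le := hf.one_le
  le := hf.le
  two_le := hf.two_le
  lower := hf.lower
  upper := hf.upper
  support m hm := hf.support _ (by rwa [abs_neg])
  recurrence m := by
    have h := hf.recurrence (-m)
    have e1 : offDiag a b (-m) = offDiag a b (m - 1) := by
      rw [offDiag, ladderCoeff_neg, ladderCoeff_neg, offDiag]
    have e2 : offDiag a b (-m - 1) = offDiag a b m := by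
      rw [show -m - 1 = -(m + 1) by ring, offDiag, ladderCoeff_neg, ladderCoeff_neg,
        add_sub_cancel_right, offDiag]
    rw [e1, e2] at h
    push_cast at h
    rw [neg_sq] at h
    rw [h, show -(m + 1) = -m - 1 by ring, show -(m - 1) = -m + 1 by ring]
    ring
  norm := by
    refine le_of_eq_of_le ?_ hf.norm
    refine Finset.sum_bij' (fun m _ ↦ -m) (fun m _ ↦ -m) ?_ ?_ ?_ ?_ ?_ <;>
      simp only [Finset.mem_Icc, neg_neg, implies_true] <;> intros <;> omega

theorem sq_pow_mul_sq_le_of_int (hf : IsThreeTermSolution a b Z f) (hZ : √(heightSq a b Z) ≤ Z)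
    (m : ℤ) : (f m ^ 2) ^ 5 * (a : ℝ) ^ 2 ≤ 10 ^ 71 := by
  by_cases hm : |m| ≤ a
  · obtain ⟨k, rfl | rfl⟩ := m.eq_nat_or_neg
    · exact hf.sq_pow_mul_sq_le hZ (by simpa using hm)
    · exact hf.comp_neg.sq_pow_mul_sq_le hZ (by simpa using hm)
  · rw [hf.support m hm]; norm_num

end IsThreeTermSolution

/-! ### The bound for the Clebsch-Gordan coefficients -/

/-- The recurrence in `m` satisfied by `C_{a m b -m}^{l 0}` comes from lowering to weight `-1` and
raising back. -/
theorem isThreeTermSolution_cg {a b l : ℕ} (ha : 1 ≤ a) (hab : a ≤ b) (hl : 1 ≤ l)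
    (h1 : b ≤ a + l) (h2 : l ≤ a + b) :
    IsThreeTermSolution a b ((l : ℝ) * (l + 1)) (fun m ↦ cg a b l m (-m)) where
  one_le := ha
  le := hab
  two_le := by
    have : (1 : ℝ) ≤ l := by exact_mod_cast hl
    nlinarith
  lower := by
    have h1' : (b : ℝ) - a ≤ l := by rw [sub_le_iff_le_add']; exact_mod_cast h1
    have h2' : 0 ≤ (b : ℝ) - a := sub_nonneg.mpr (by exact_mod_cast hab)
    gcongr
  upper := by
    have h2' : (l : ℝ) ≤ a + b := by exact_mod_cast h2
    gcongr
  support m hm := cg_eq_zero_of_left hm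
  recurrence m := by
    by_cases hm : |m| ≤ a
    · rw [abs_le] at hm
      have e1 := cg_lowering a b l m (-m)
      have e2 := cg_raising a b l (m + 1) (-m)
      have e3 := cg_raising a b l m (-m + 1)
      rw [add_neg_cancel] at e1
      rw [show m + 1 + -m - 1 = 0 by ring, add_sub_cancel_right,
        show -m - 1 = -(m + 1) by ring, ladderCoeff_neg, add_sub_cancel_right] at e2
      rw [show m + (-m + 1) - 1 = 0 by ring, add_sub_cancel_right] at e3
      have e4 := ladderCoeff_neg b m
      have e5 := ladderCoeff_zero_sq l
      have e6 := ladderCoeff_sq (l := a) (m := m) (by omega) (by omega)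
      have e7 := ladderCoeff_sq (l := b) (m := -m) (by omega) (by omega)
      rw [show -m + 1 = -(m - 1) by ring] at e1 e3
      rw [offDiag, offDiag, casimir, casimir, ← e4]
      push_cast at e7
      linear_combination ladderCoeff l 0 * e1 - cg a b l m (-m) * e5 +
        ladderCoeff a m * e2 + ladderCoeff b (-m) * e3 + cg a b l m (-m) * (e6 + e7)
    · have z1 : offDiag a b m * cg a b l (m + 1) (-(m + 1)) = 0 := by
        rw [offDiag, mul_right_comm, ladderCoeff_mul_eq_zero hm cg_eq_zero_of_left, zero_mul]
      have z2 : offDiag a b (m - 1) * cg a b l (m - 1) (-(m - 1)) = 0 := by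
        rw [offDiag, mul_right_comm, ladderCoeff_sub_one_mul_eq_zero hm cg_eq_zero_of_left,
          zero_mul]
      rw [z1, z2, cg_eq_zero_of_left hm]; simp
  norm := by simpa using sum_cg_sq_le_one a b l 0

/-- The bound `|C_{a m b -m}^{l 0}| ≤ c * (2 a + 1) ^ (-1 / 5)` for `a ≤ b`, to the tenth power. -/
theorem cg_sq_pow_mul_sq_le_of_le {a b : ℕ} (hab : a ≤ b) (l : ℕ) (m : ℤ) :
    (cg a b l m (-m) ^ 2) ^ 5 * (2 * (a : ℝ) + 1) ^ 2 ≤ 10 ^ 72 := by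
  have hq0 : 0 ≤ cg a b l m (-m) ^ 2 := sq_nonneg _
  have hq := cg_sq_le_one a b l m (-m)
  rcases Nat.eq_zero_or_pos a with rfl | ha
  · have := pow_le_one₀ hq0 hq (n := 5)
    norm_num at this ⊢
    linarith
  have ha' : (1 : ℝ) ≤ a := by exact_mod_cast ha
  have hab' : (a : ℝ) ≤ b := by exact_mod_cast hab
  by_cases h0 : cg a b l m (-m) = 0
  · rw [h0]; norm_num
  obtain ⟨-, -, -, hs1, -, hs2⟩ := cg_support h0
  suffices h : (cg a b l m (-m) ^ 2) ^ 5 * (a : ℝ) ^ 2 ≤ 10 ^ 71 by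
    calc (cg a b l m (-m) ^ 2) ^ 5 * (2 * (a : ℝ) + 1) ^ 2 ≤
          (cg a b l m (-m) ^ 2) ^ 5 * (3 * a) ^ 2 := by gcongr; linarith
      _ = 9 * ((cg a b l m (-m) ^ 2) ^ 5 * (a : ℝ) ^ 2) := by ring
      _ ≤ 9 * 10 ^ 71 := by gcongr
      _ ≤ _ := by norm_num
  rcases le_or_gt ((2 * (l : ℝ) + 1) ^ 2) (9 * (a : ℝ)) with hl | hl
  · -- for small `l`, the symmetry exchanging `b` and `l` gives `q ≤ (2 l + 1) / (2 b + 1)`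
    have h1 := cg_sq_exchange a b l m (-m)
    have h2 := cg_sq_le_one a l b m (-(m + -m))
    generalize cg a b l m (-m) ^ 2 = q at *
    have h3 : (2 * (a : ℝ)) * q ≤ 2 * l + 1 := by nlinarith
    have h4 := (pow_le_pow_left₀ (by positivity) h3 2).trans hl
    have h5 : (a : ℝ) * (q ^ 2 * a) ≤ a * (9 / 4) := by linarith
    have h6 := le_of_mul_le_mul_left h5 (by linarith)
    calc q ^ 5 * (a : ℝ) ^ 2 = q * (q ^ 2 * a) ^ 2 := by ring
      _ ≤ 1 * (9 / 4) ^ 2 := by gcongr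
      _ ≤ _ := by norm_num
  · have hl1 : 1 ≤ l := by
      by_contra hcon
      have : l = 0 := by omega
      rw [this] at hl
      norm_num at hl
      linarith
    have hf := isThreeTermSolution_cg ha hab hl1 hs2 hs1
    refine hf.sq_pow_mul_sq_le_of_int ?_ m
    refine (Real.sqrt_le_sqrt hf.heightSq_le_casimir).trans ?_
    refine (Real.sqrt_le_left (by positivity)).mpr ?_
    have h1 : (a : ℝ) + 1 ≤ l * (l + 1) := by nlinarith
    have h2 := pow_le_pow_left₀ (by positivity) h1 2
    rw [casimir]
    nlinarith

theorem cg_sq_pow_mul_sq_le (a b l : ℕ) (m : ℤ) :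
    (cg a b l m (-m) ^ 2) ^ 5 * (2 * (min a b : ℝ) + 1) ^ 2 ≤ 10 ^ 72 := by
  rcases le_total a b with h | h
  · rw [min_eq_left (by exact_mod_cast h)]
    exact cg_sq_pow_mul_sq_le_of_le h l m
  · rw [min_eq_right (by exact_mod_cast h), cg_swap, neg_neg]
    exact cg_sq_pow_mul_sq_le_of_le h l m

theorem cg_sq_le_rpow (a b l : ℕ) (m : ℤ) :
    cg a b l m (-m) ^ 2 ≤ (10 ^ 8 * (2 * (min a b : ℝ) + 1) ^ (-(1 / 5) : ℝ)) ^ 2 := by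
  have h := cg_sq_pow_mul_sq_le a b l m
  have hx : 0 < 2 * (min a b : ℝ) + 1 := by positivity
  generalize 2 * (min a b : ℝ) + 1 = x at *
  refine le_of_pow_le_pow_left₀ (n := 5) (by norm_num) (by positivity) ?_
  have e : (x ^ (-(1 / 5) : ℝ)) ^ 10 * x ^ 2 = 1 := by
    rw [← Real.rpow_natCast, ← Real.rpow_mul hx.le, ← Real.rpow_natCast, ← Real.rpow_add hx]
    norm_num
  refine le_of_mul_le_mul_right (a := x ^ 2) ?_ (by positivity)
  calc _ ≤ (10 : ℝ) ^ 72 := h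
    _ ≤ 10 ^ 80 * ((x ^ (-(1 / 5) : ℝ)) ^ 10 * x ^ 2) := by rw [e]; norm_num
    _ = _ := by ring

/-! ### The bound for the sum of products of `6j` coefficients -/

theorem min_rpow_neg_eq {x y p : ℝ} (hx : 0 < x) (hy : 0 < y) (hp : p ≤ 0) :
    min (x ^ p) (y ^ p) = max x y ^ p := by
  rcases le_total x y with h | h
  · rw [max_eq_right h, min_eq_right (Real.rpow_le_rpow_of_nonpos hx h hp)]
  · rw [max_eq_left h, min_eq_left (Real.rpow_le_rpow_of_nonpos hy h hp)]

theorem max_rpow_neg_eq {x y p : ℝ} (hx : 0 < x) (hy : 0 < y) (hp : p ≤ 0) :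
    max (x ^ p) (y ^ p) = min x y ^ p := by
  rcases le_total x y with h | h
  · rw [min_eq_left h, max_eq_left (Real.rpow_le_rpow_of_nonpos hx h hp)]
  · rw [min_eq_right h, max_eq_right (Real.rpow_le_rpow_of_nonpos hy h hp)]

theorem mainTheorem10 :
    ∃ c : ℝ, 0 < c ∧ ∀ l l₁ l₂ j₁ j₂ : ℕ,
      ∑ s ∈ Finset.range (2 * l + 1),
          (2 * (s : ℝ) + 1) * (2 * (l : ℝ) + 1) * clebschGordan l 0 s 0 l 0 ^ 2 *
            sixJ l₁ j₁ l l s l₂ * sixJ l₁ j₂ l l s l₂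
        ≤ c * max
            (min ((2 * (l₁ : ℝ) + 1) ^ (-(1 / 5) : ℝ)) ((2 * (l₂ : ℝ) + 1) ^ (-(1 / 5) : ℝ)))
            (min ((2 * (j₁ : ℝ) + 1) ^ (-(1 / 5) : ℝ)) ((2 * (j₂ : ℝ) + 1) ^ (-(1 / 5) : ℝ))) := by
  refine ⟨10 ^ 8, by norm_num, fun l l₁ l₂ j₁ j₂ ↦ ?_⟩
  have hmax : ∀ p q : ℕ, max (2 * (p : ℝ) + 1) (2 * (q : ℝ) + 1) = 2 * (max p q : ℕ) + 1 := by
    intro p q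
    rw [max_add_add_right, ← mul_max_of_nonneg _ _ (by norm_num : (0 : ℝ) ≤ 2), Nat.cast_max]
  rw [min_rpow_neg_eq (by positivity) (by positivity) (by norm_num),
    min_rpow_neg_eq (by positivity) (by positivity) (by norm_num), hmax, hmax,
    max_rpow_neg_eq (by positivity) (by positivity) (by norm_num), min_add_add_right,
    ← mul_min_of_nonneg _ _ (by norm_num : (0 : ℝ) ≤ 2)]
  exact sum_sixJ_le (by grind) (by grind) (by positivity) (cg_sq_le_rpow _ _ l)
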